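/- Let $p$ be an odd prime and let $T$ be the regular $p$-adic rooted tree, whose vertices are the finite words over the alphabet $X=\{1,2,\dots,p\}$ (the root is the empty word, and each word $v$ is joined to $vx$ for every letter $x\in X$). For an automorphism $g\in\mathrm{Aut}(T)$ fixing the first level pointwise write $\psi_1(g)=(g_1,\dots,g_p)\in\mathrm{Aut}(T)^p$, where $g_j$ is the restriction of $g$ to the subtree of words beginning with the letter $j$, identified with $T$ by deleting that letter. Let $a\in\mathrm{Aut}(T)$ be the rooted automorphism that permutes the first letter of every nonempty word by the $p$-cycle $(1\,2\,\dots\,p)$ and leaves the remaining letters unchanged. For $r\ge 1$ and $\mathbb{Z}/p\mathbb{Z}$-linearly independent vectors $\mathbf e_i=(e_{i,1},\dots,e_{i,p-1})\in(\mathbb{Z}/p\mathbb{Z})^{p-1}$, $1\le i\le r$, define recursively $b_1,\dots,b_r\in\mathrm{Aut}(T)$, fixing the first level, by $$\psi_1(b_i)=(a^{e_{i,1}},\dots,a^{e_{i,p-1}},b_i).$$ The subgroup $\langle a,b_1,\dots,b_r\rangle\le\mathrm{Aut}(T)$ is called the multi-edge spinal group with defining vectors $\mathbf e_1,\dots,\mathbf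 e_r$. Let $\boldsymbol{\mathcal E}$ be the family of all multi-edge spinal groups $\langle a,b_1,\dots,b_r\rangle$ on $T$ (for any $r\ge1$) whose defining vectors satisfy - $\mathbf e_1=(1,0,\dots,0)$, that is, $\psi_1(b_1)=(a,1,\dots,1,b_1)$; - $e_{i,1}=1$ for every $i\in\{1,\dots,r\}$; - $e_{i,p-1}\ne 0$ for at least one $i\in\{1,\dots,r\}$. A group is just infinite if it is infinite and each of its nontrivial normal subgroups has finite index. The profinite topology on a group is the topology having as a base the cosets of the subgroups of finite index. **Theorem.** Let $G=\langle a,b_1,\dots,b_r\rangle$ be a just infinite multi-edge spinal group on $T$, and suppose that $G$ is not conjugate in $\mathrm{Aut}(T)$ to a group in $\boldsymbol{\mathcal E}$. Then $G$ has no proper torsion subgroup that is dense in the profinite topology of $G$. -/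

import Mathlib

/-- The automorphism group `Aut(T)` of the regular rooted tree `T` over the alphabet `X`.
The vertices of `T` are the finite words over `X` (the root is the empty word), and an edge joins
`v` to `v ++ [x]` for every word `v` and every letter `x`. An automorphism is a permutation of the
vertices that fixes the root and maps children of `v` to children of the image of `v`. -/
def TreeAut (X : Type*) : Subgroup (Equiv.Perm (List X)) where
  carrier := {f | f [] = [] ∧ ∀ (v : List X) (x : X), ∃ y : X, f (v ++ [x]) = f v ++ [y]}
  one_mem' := ⟨rfl, fun _ x => ⟨x, rfl⟩⟩
  mul_mem' := by
    rintro f g ⟨hf, hf'⟩ ⟨hg, hg'⟩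
    refine ⟨by simp [hf, hg], fun v x => ?_⟩
    obtain ⟨y, hy⟩ := hg' v x
    obtain ⟨z, hz⟩ := hf' (g v) y
    exact ⟨z, by simp [hy, hz]⟩
  inv_mem' := by
    rintro f ⟨hf, hf'⟩
    refine ⟨by rw [Equiv.Perm.inv_eq_iff_eq, hf], fun v x => ?_⟩
    rcases List.eq_nil_or_concat' (f⁻¹ (v ++ [x])) with h | ⟨w, y, h⟩
    · rw [Equiv.Perm.inv_eq_iff_eq, hf] at h
      simp at h
    · refine ⟨y, ?_⟩
      have h1 := Equiv.Perm.inv_eq_iff_eq.mp h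
      obtain ⟨z, hz⟩ := hf' w y
      rw [hz] at h1
      have h2 : v = f w := (List.append_inj' h1 rfl).1
      rw [h, h2]
      simp

/-- The action on words that adds `k` to the first letter and fixes all other letters. The alphabet
`{1, …, p}` is identified with `ZMod p`, so that the last letter `p` is `0`. -/
def rootedFun {p : ℕ} (k : ZMod p) : List (ZMod p) → List (ZMod p)
  | [] => []
  | x :: w => (x + k) :: w

/-- The rooted automorphism `a` of the `p`-adic tree that corresponds to the `p`-cycle
`(1 2 … p)`. -/
def spinalA (p : ℕ) : TreeAut (ZMod p) :=
  ⟨{ toFun := rootedFun 1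
     invFun := rootedFun (-1)
     left_inv := by rintro (_ | ⟨x, w⟩) <;> simp [rootedFun]
     right_inv := by rintro (_ | ⟨x, w⟩) <;> simp [rootedFun] },
   rfl, by
    rintro (_ | ⟨y, v⟩) x
    · exact ⟨x + 1, rfl⟩
    · exact ⟨x, rfl⟩⟩

/-- The letters `1, …, p - 1`, as the nonzero residues mod `p`. -/
abbrev NonlastLetter (p : ℕ) : Type := {j : ZMod p // j ≠ 0}

/-- The action on words of the map `d` that is determined recursively by
`ψ₁(d) = (s 1, …, s (p - 1), d)`. -/
def directedFun {p : ℕ} (s : NonlastLetter p → TreeAut (ZMod p)) :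
    List (ZMod p) → List (ZMod p)
  | [] => []
  | x :: w => if h : x = 0 then x :: directedFun s w
      else x :: (s ⟨x, h⟩ : Equiv.Perm (List (ZMod p))) w

theorem directedFun_leftInverse {p : ℕ} (s t : NonlastLetter p → TreeAut (ZMod p))
    (hst : ∀ j, s j * t j = 1) : Function.LeftInverse (directedFun s) (directedFun t) := by
  intro w
  induction w with
  | nil => rfl
  | cons x w ih =>
    by_cases h : x = 0
    · simp [directedFun, h, ih]
    · have h1 := congrArg (fun f : TreeAut (ZMod p) => (f : Equiv.Perm (List (ZMod p))) w)
        (hst ⟨x, h⟩)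
      simpa [directedFun, h] using h1

/-- The automorphism `d`, fixing the first level, that is determined recursively by
`ψ₁(d) = (s 1, …, s (p - 1), d)`. -/
def directedAut {p : ℕ} (s : NonlastLetter p → TreeAut (ZMod p)) : TreeAut (ZMod p) :=
  ⟨{ toFun := directedFun s
     invFun := directedFun (fun j => (s j)⁻¹)
     left_inv := directedFun_leftInverse _ _ (fun j => inv_mul_cancel (s j))
     right_inv := directedFun_leftInverse _ _ (fun j => mul_inv_cancel (s j)) },
   rfl, by
    intro v x
    change ∃ y, directedFun s (v ++ [x]) = directedFun s v ++ [y]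
    induction v with
    | nil =>
      by_cases h : x = 0
      · exact ⟨x, by simp [directedFun, h]⟩
      · exact ⟨x, by simp [directedFun, h, (s ⟨x, h⟩).2.1]⟩
    | cons z v ih =>
      by_cases h : z = 0
      · obtain ⟨y, hy⟩ := ih
        exact ⟨y, by simp [directedFun, h, hy]⟩
      · obtain ⟨y, hy⟩ := (s ⟨z, h⟩).2.2 v x
        exact ⟨y, by simp [directedFun, h, hy]⟩⟩

/-- Vectors `e = (e_1, …, e_{p-1})` over `ℤ/pℤ`. In particular `e_{p-1}` is the coordinate at
`-1 : ZMod p`. -/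
abbrev DefiningVector (p : ℕ) : Type := NonlastLetter p → ZMod p

/-- The directed automorphism `b` with `ψ₁(b) = (a ^ e_1, …, a ^ e_{p-1}, b)`. -/
def spinalB {p : ℕ} (e : DefiningVector p) : TreeAut (ZMod p) :=
  directedAut (fun j => spinalA p ^ (e j).val)

/-- The group `⟨a, b_1, …, b_r⟩` with defining vectors `E`. It is the multi-edge spinal group
associated to `E` when `p` is an odd prime, `r ≥ 1` and `E` is linearly independent. -/
def multiEdgeSpinalGroup {p r : ℕ} (E : Fin r → DefiningVector p) : Subgroup (TreeAut (ZMod p)) :=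
  Subgroup.closure ({spinalA p} ∪ Set.range (fun i => spinalB (E i)))

/-- The family of multi-edge spinal groups with defining vectors `e_1, …, e_r` such that
`e_1 = (1, 0, …, 0)`, i.e. `ψ₁(b_1) = (a, 1, …, 1, b_1)`, `e_{i,1} = 1` for all `i`, and
`e_{i,p-1} ≠ 0` for some `i`. -/
def InFamilyE {p : ℕ} [Fact p.Prime] (G : Subgroup (TreeAut (ZMod p))) : Prop :=
  ∃ (r : ℕ) (hr : 0 < r) (E : Fin r → DefiningVector p),
    LinearIndependent (ZMod p) E ∧
    G = multiEdgeSpinalGroup E ∧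
    (∀ j : NonlastLetter p, E ⟨0, hr⟩ j = if (j : ZMod p) = 1 then 1 else 0) ∧
    (∀ i, E i ⟨1, one_ne_zero⟩ = 1) ∧
    (∃ i, E i ⟨-1, neg_ne_zero.mpr one_ne_zero⟩ ≠ 0)

/-- A group is just infinite if it is infinite and all its nontrivial normal subgroups have finite
index. -/
def IsJustInfinite (G : Type*) [Group G] : Prop :=
  Infinite G ∧ ∀ N : Subgroup G, N.Normal → N ≠ ⊥ → N.FiniteIndex

/-- The profinite topology on a group, generated by the cosets of the subgroups of finite index. -/
@[reducible]
def profiniteTopology (G : Type*) [Group G] : TopologicalSpace G :=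
  TopologicalSpace.generateFrom
    {U | ∃ (g : G) (N : Subgroup G), N.FiniteIndex ∧ U = (fun x => g * x) '' (N : Set G)}

/-! Let `W` be the span of the defining vectors, so that the group is `G = spinalGroup W`. Every
element of `G` is a product of syllables (conjugates of directed automorphisms by rotations)
followed by a rotation, with a total vector in `W`. Its sections share out the syllables: their
lengths add up to at most the original length, their vectors add up to the original vector, and all
of them are strictly shorter unless the element is one syllable times a rotation.

Let `M` be a dense torsion subgroup. By density `M` contains elements with any prescribed rotation
and total vector. A nontrivial rotation together with a vector of nonzero coordinate sum forces
infinite order (`HasWord.not_isOfFinOrder`), so all coordinate sums on `W` vanish, and then `G`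
itself is torsion (`isOfFinOrder_of_mem`).

Descent: section groups of dense subgroups are dense (`DenseIn.sectGroup`). Passing repeatedly to
sections shortens words and produces a directed automorphism (`eq_of_hasWord_mem`), then rotations
(`eq_of_syl_mem`, `eq_of_conj_rot_mem`), then all directed automorphisms (`eq_of_rot_mem`); some
iterated section group is therefore `G`.

Ascent (`eq_of_sectGroup_eq`): if a section group of `M` is `G`, just infiniteness shows that the
elements of `M` supported on a single first-level subtree have sections forming a finite-index
subgroup of `G`. Hence `M` contains a finite-index subgroup of `G`, and density gives `M = G`. -/

/-! ### First-level action and sections of tree automorphisms. -/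

/-- The image of the first-level vertex `x` under a tree automorphism. -/
def act {X : Type*} (f : TreeAut X) (x : X) : X := ((f : Equiv.Perm (List X)) [x]).headD x

theorem apply_nil {X : Type*} (f : TreeAut X) : (f : Equiv.Perm (List X)) [] = [] := f.2.1

theorem apply_singleton {X : Type*} (f : TreeAut X) (x : X) :
    (f : Equiv.Perm (List X)) [x] = [act f x] := by
  obtain ⟨y, hy⟩ := f.2.2 [] x
  have h : (f : Equiv.Perm (List X)) [x] = [y] := by simpa [apply_nil f] using hy
  simp [act, h]

theorem apply_cons_tail {X : Type*} (f : TreeAut X) (x : X) (w : List X) :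
    (f : Equiv.Perm (List X)) (x :: w) = act f x :: ((f : Equiv.Perm (List X)) (x :: w)).tail := by
  induction w using List.reverseRecOn with
  | nil => simp [apply_singleton]
  | append_singleton w z ih =>
    obtain ⟨y, hy⟩ := f.2.2 (x :: w) z
    rw [List.cons_append] at hy
    rw [hy, ih]
    simp

theorem act_inv_act {X : Type*} (f : TreeAut X) (x : X) : act f⁻¹ (act f x) = x := by
  have h : (f⁻¹ : TreeAut X).1 (f.1 [x]) = [x] := by simp
  rw [apply_singleton, apply_singleton] at h
  simpa using h

theorem act_act_inv {X : Type*} (f : TreeAut X) (x : X) : act f (act f⁻¹ x) = x := by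
  simpa using act_inv_act f⁻¹ x

theorem tail_apply_inverse {X : Type*} (f : TreeAut X) (x : X) (w : List X) :
    (f⁻¹.1 (act f x :: (f.1 (x :: w)).tail)).tail = w := by
  rw [← apply_cons_tail]
  simp

/-- The section (restriction to the subtree at the first-level vertex `x`) of a tree
automorphism. -/
def sect {X : Type*} (f : TreeAut X) (x : X) : TreeAut X :=
  ⟨{ toFun := fun w => (f.1 (x :: w)).tail
     invFun := fun w => (f⁻¹.1 (act f x :: w)).tail
     left_inv := fun w => tail_apply_inverse f x w
     right_inv := fun w => by
      have h := tail_apply_inverse f⁻¹ (act f x) w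
      rw [act_inv_act, inv_inv] at h
      exact h },
    by
      change (f.1 [x]).tail = []
      simp [apply_singleton], by
      intro v z
      change ∃ y, (f.1 (x :: (v ++ [z]))).tail = (f.1 (x :: v)).tail ++ [y]
      obtain ⟨y, hy⟩ := f.2.2 (x :: v) z
      refine ⟨y, ?_⟩
      rw [List.cons_append] at hy
      rw [hy, apply_cons_tail f x v]
      simp⟩

theorem apply_cons {X : Type*} (f : TreeAut X) (x : X) (w : List X) :
    f.1 (x :: w) = act f x :: (sect f x).1 w := apply_cons_tail f x w

theorem treeAut_ext {X : Type*} {f g : TreeAut X} (h1 : ∀ x, act f x = act g x)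
    (h2 : ∀ x, sect f x = sect g x) : f = g := by
  apply Subtype.ext
  apply Equiv.ext
  rintro (_ | ⟨x, w⟩)
  · rw [f.2.1, g.2.1]
  · rw [apply_cons, apply_cons, h1, h2]

theorem act_sect_eq {X : Type*} {f g : TreeAut X} {x y : X}
    (h : ∀ w, f.1 (x :: w) = y :: g.1 w) : act f x = y ∧ sect f x = g := by
  constructor
  · have := h []
    rw [apply_cons] at this
    exact (List.cons.inj this).1
  · apply Subtype.ext
    apply Equiv.ext
    intro w
    have := h w
    rw [apply_cons] at this
    exact (List.cons.inj this).2

@[simp] theorem act_one {X : Type*} (x : X) : act (1 : TreeAut X) x = x :=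
  (act_sect_eq (g := 1) fun _ => rfl).1

@[simp] theorem sect_one {X : Type*} (x : X) : sect (1 : TreeAut X) x = 1 :=
  (act_sect_eq (y := x) fun _ => rfl).2

theorem apply_mul_cons {X : Type*} (f g : TreeAut X) (x : X) (w : List X) :
    (f * g).1 (x :: w) = act f (act g x) :: (sect f (act g x) * sect g x).1 w := by
  change f.1 (g.1 (x :: w)) = _ :: (sect f (act g x)).1 ((sect g x).1 w)
  rw [apply_cons, apply_cons]

theorem act_mul {X : Type*} (f g : TreeAut X) (x : X) : act (f * g) x = act f (act g x) :=
  (act_sect_eq (apply_mul_cons f g x)).1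

theorem sect_mul {X : Type*} (f g : TreeAut X) (x : X) :
    sect (f * g) x = sect f (act g x) * sect g x :=
  (act_sect_eq (apply_mul_cons f g x)).2

theorem sect_inv {X : Type*} (f : TreeAut X) (x : X) :
    sect f⁻¹ (act f x) = (sect f x)⁻¹ := by
  rw [eq_inv_iff_mul_eq_one, ← sect_mul]
  simp

/-- The stabilizer of the first level. -/
def levelStab (X : Type*) : Subgroup (TreeAut X) where
  carrier := {f | ∀ x, act f x = x}
  one_mem' := fun x => act_one x
  mul_mem' := fun {f g} hf hg x => by rw [act_mul, hg, hf]
  inv_mem' := fun {f} hf x => by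
    conv_lhs => rw [← hf x]
    exact act_inv_act f x

/-- Sections of elements of the first-level stabilizer, as a homomorphism. -/
def sectHom {X : Type*} (x : X) : levelStab X →* TreeAut X where
  toFun f := sect f.1 x
  map_one' := sect_one x
  map_mul' f g := by
    change sect (f.1 * g.1) x = _
    rw [sect_mul, g.2 x]

/-- The group of sections at `x` of the elements of `M` that fix the first-level vertex `x`. -/
def sectGroup {X : Type*} (M : Subgroup (TreeAut X)) (x : X) : Subgroup (TreeAut X) where
  carrier := {g | ∃ m ∈ M, act m x = x ∧ sect m x = g}
  one_mem' := ⟨1, M.one_mem, act_one x, sect_one x⟩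
  mul_mem' := by
    rintro _ _ ⟨m, hm, h1, rfl⟩ ⟨n, hn, h2, rfl⟩
    exact ⟨m * n, M.mul_mem hm hn, by rw [act_mul, h2, h1], by rw [sect_mul, h2]⟩
  inv_mem' := by
    rintro _ ⟨m, hm, h1, rfl⟩
    have h2 := act_inv_act m x
    have h3 := sect_inv m x
    rw [h1] at h2 h3
    exact ⟨m⁻¹, M.inv_mem hm, h2, h3⟩

theorem sect_mem_sectGroup {X : Type*} {M : Subgroup (TreeAut X)} {m : TreeAut X} {x : X}
    (hm : m ∈ M) (h : act m x = x) : sect m x ∈ sectGroup M x := ⟨m, hm, h, rfl⟩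

theorem conj_mem_sectGroup {X : Type*} {M : Subgroup (TreeAut X)} {t g : TreeAut X} {x : X}
    (ht : t ∈ M) (hg : g ∈ sectGroup M (act t x)) :
    (sect t x)⁻¹ * g * sect t x ∈ sectGroup M x := by
  obtain ⟨m, hm, h1, rfl⟩ := hg
  refine ⟨t⁻¹ * m * t, M.mul_mem (M.mul_mem (M.inv_mem ht) hm) ht, ?_, ?_⟩
  · rw [act_mul, act_mul, h1, act_inv_act]
  · rw [sect_mul, sect_mul, h1, sect_inv]

/-! ### Rooted and directed automorphisms. -/

/-- The rooted automorphism adding `k` to the first letter. -/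
def rot {p : ℕ} (k : ZMod p) : TreeAut (ZMod p) :=
  ⟨{ toFun := rootedFun k
     invFun := rootedFun (-k)
     left_inv := by rintro (_ | ⟨x, w⟩) <;> simp [rootedFun]
     right_inv := by rintro (_ | ⟨x, w⟩) <;> simp [rootedFun] },
   rfl, by
    rintro (_ | ⟨y, v⟩) x
    · exact ⟨x + k, rfl⟩
    · exact ⟨x, rfl⟩⟩

@[simp] theorem act_rot {p : ℕ} (k x : ZMod p) : act (rot k) x = x + k := rfl

@[simp] theorem sect_rot {p : ℕ} (k x : ZMod p) : sect (rot k) x = 1 := rfl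

theorem rot_add {p : ℕ} (k l : ZMod p) : rot (k + l) = rot k * rot l :=
  treeAut_ext (fun x => by simp only [act_mul, act_rot]; ring) (fun x => by simp [sect_mul])

@[simp] theorem rot_zero {p : ℕ} : rot (0 : ZMod p) = 1 :=
  treeAut_ext (fun x => by simp) (fun x => by simp)

theorem rot_neg {p : ℕ} (k : ZMod p) : rot (-k) = (rot k)⁻¹ := by
  rw [eq_inv_iff_mul_eq_one, ← rot_add]
  simp

theorem rot_one {p : ℕ} : rot (1 : ZMod p) = spinalA p := rfl

theorem rot_eq_pow {p : ℕ} [NeZero p] (k : ZMod p) : rot k = spinalA p ^ k.val := by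
  have h : ∀ n : ℕ, rot (n : ZMod p) = spinalA p ^ n := by
    intro n
    induction n with
    | zero => simp
    | succ n ih => rw [Nat.cast_succ, rot_add, ih, rot_one, pow_succ]
  rw [← h, ZMod.natCast_zmod_val]

theorem rot_nsmul {p : ℕ} (n : ℕ) (k : ZMod p) : rot (n • k) = rot k ^ n := by
  induction n with
  | zero => simp
  | succ n ih => rw [succ_nsmul, rot_add, ih, pow_succ]

theorem rot_mem_of_rot_mem {p : ℕ} [Fact p.Prime] {M : Subgroup (TreeAut (ZMod p))} {k : ZMod p}
    (hk : k ≠ 0) (h : rot k ∈ M) (l : ZMod p) : rot l ∈ M := by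
  have : l = (l * k⁻¹).val • k := by
    rw [nsmul_eq_mul, ZMod.natCast_zmod_val, mul_assoc, inv_mul_cancel₀ hk, mul_one]
  rw [this, rot_nsmul]
  exact M.pow_mem h _

theorem rot_injective {p : ℕ} : Function.Injective (rot (p := p)) := by
  intro k l h
  have := congrArg (fun f => act f 0) h
  simpa using this

/-- The coordinates of a defining vector, extended by `0` to the last letter. -/
def coord {p : ℕ} (v : DefiningVector p) (x : ZMod p) : ZMod p := if h : x = 0 then 0 else v ⟨x, h⟩

@[simp] theorem coord_zero_right {p : ℕ} (v : DefiningVector p) : coord v 0 = 0 := by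
  simp [coord]

@[simp] theorem coord_zero_left {p : ℕ} (x : ZMod p) : coord (0 : DefiningVector p) x = 0 := by
  simp [coord]

theorem coord_add {p : ℕ} (v w : DefiningVector p) (x : ZMod p) :
    coord (v + w) x = coord v x + coord w x := by
  unfold coord
  split_ifs <;> simp

theorem exists_coord_ne_zero {p : ℕ} {v : DefiningVector p} (hv : v ≠ 0) :
    ∃ x, x ≠ 0 ∧ coord v x ≠ 0 := by
  obtain ⟨x, hx⟩ := Function.ne_iff.mp hv
  exact ⟨x, x.2, by simpa [coord, x.2] using hx⟩

/-- The sum of the coordinates of a defining vector. -/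
def coordSum {p : ℕ} [NeZero p] (v : DefiningVector p) : ZMod p := ∑ x, coord v x

theorem coordSum_zero {p : ℕ} [NeZero p] : coordSum (0 : DefiningVector p) = 0 := by
  simp [coordSum]

theorem coordSum_add {p : ℕ} [NeZero p] (v w : DefiningVector p) :
    coordSum (v + w) = coordSum v + coordSum w := by
  simp [coordSum, coord_add, Finset.sum_add_distrib]

/-- A vector with a single nonzero coordinate has nonzero sum, so vanishing sum leaves a nonzero
coordinate away from any given position. -/
theorem exists_coord_ne_zero_ne {p : ℕ} [NeZero p] {v : DefiningVector p} (hv : v ≠ 0)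
    (h : coordSum v = 0) (i : ZMod p) : ∃ x, x ≠ 0 ∧ x ≠ i ∧ coord v x ≠ 0 := by
  by_contra! hc
  obtain ⟨x, hx, hvx⟩ := exists_coord_ne_zero hv
  have hall : ∀ y, y ≠ i → coord v y = 0 := by
    intro y hy
    by_cases h0 : y = 0
    · simp [h0]
    · exact hc y h0 hy
  have hxi : x = i := by
    by_contra hne
    exact hvx (hall x hne)
  rw [coordSum, Finset.sum_eq_single i (fun y _ hy => hall y hy) (by simp)] at h
  exact hvx (hxi ▸ h)

@[simp] theorem act_spinalB {p : ℕ} (v : DefiningVector p) (x : ZMod p) :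
    act (spinalB v) x = x := by
  by_cases h : x = 0
  · refine (act_sect_eq (g := spinalB v) fun w => ?_).1
    change directedFun _ _ = _
    simp [directedFun, h]
    rfl
  · refine (act_sect_eq (g := spinalA p ^ (v ⟨x, h⟩).val) fun w => ?_).1
    change directedFun _ _ = _
    simp [directedFun, h]

theorem sect_spinalB_zero {p : ℕ} (v : DefiningVector p) : sect (spinalB v) 0 = spinalB v := by
  refine (act_sect_eq (y := 0) fun w => ?_).2
  change directedFun _ _ = _
  simp [directedFun]
  rfl

theorem sect_spinalB {p : ℕ} [NeZero p] (v : DefiningVector p) {x : ZMod p} (h : x ≠ 0) :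
    sect (spinalB v) x = rot (coord v x) := by
  rw [coord, dif_neg h, rot_eq_pow]
  refine (act_sect_eq (y := x) fun w => ?_).2
  change directedFun _ _ = _
  simp [directedFun, h]

theorem spinalB_add {p : ℕ} [NeZero p] (v w : DefiningVector p) :
    spinalB (v + w) = spinalB v * spinalB w := by
  apply Subtype.ext
  apply Equiv.ext
  intro u
  induction u with
  | nil => rw [apply_nil, apply_nil]
  | cons x u ih =>
    rw [apply_cons, apply_cons, act_mul, sect_mul]
    simp only [act_spinalB]
    by_cases h : x = 0
    · subst h
      rw [sect_spinalB_zero, sect_spinalB_zero, sect_spinalB_zero, ih]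
    · rw [sect_spinalB _ h, sect_spinalB _ h, sect_spinalB _ h, coord_add, rot_add]

theorem spinalB_zero {p : ℕ} [NeZero p] : spinalB (0 : DefiningVector p) = 1 := by
  have h := spinalB_add (0 : DefiningVector p) 0
  rw [add_zero] at h
  exact left_eq_mul.mp h

theorem spinalB_neg {p : ℕ} [NeZero p] (v : DefiningVector p) : spinalB (-v) = (spinalB v)⁻¹ := by
  rw [eq_inv_iff_mul_eq_one, ← spinalB_add, neg_add_cancel, spinalB_zero]

theorem spinalB_nsmul {p : ℕ} [NeZero p] (n : ℕ) (v : DefiningVector p) :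
    spinalB (n • v) = spinalB v ^ n := by
  induction n with
  | zero => simp [spinalB_zero]
  | succ n ih => rw [succ_nsmul, spinalB_add, ih, pow_succ]

/-- The conjugate of `spinalB v` by `rot k`, which has section `spinalB v` at `k`. -/
def syl {p : ℕ} (k : ZMod p) (v : DefiningVector p) : TreeAut (ZMod p) :=
  rot k * spinalB v * rot (-k)

@[simp] theorem act_syl {p : ℕ} (k x : ZMod p) (v : DefiningVector p) : act (syl k v) x = x := by
  simp [syl, act_mul]

theorem sect_syl_self {p : ℕ} (k : ZMod p) (v : DefiningVector p) :
    sect (syl k v) k = spinalB v := by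
  simp [syl, sect_mul, sect_spinalB_zero]

theorem sect_syl {p : ℕ} [NeZero p] {k x : ZMod p} (h : x ≠ k) (v : DefiningVector p) :
    sect (syl k v) x = rot (coord v (x - k)) := by
  simp [syl, sect_mul, ← sub_eq_add_neg, sect_spinalB _ (sub_ne_zero.mpr h)]

theorem syl_add {p : ℕ} [NeZero p] (k : ZMod p) (v w : DefiningVector p) :
    syl k (v + w) = syl k v * syl k w := by
  simp only [syl, spinalB_add, rot_neg]
  group

theorem syl_zero_right {p : ℕ} [NeZero p] (k : ZMod p) : syl k (0 : DefiningVector p) = 1 := by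
  simp [syl, spinalB_zero, rot_neg]

theorem syl_zero_left {p : ℕ} (v : DefiningVector p) : syl 0 v = spinalB v := by
  simp [syl]

theorem rot_mul_syl {p : ℕ} (k l : ZMod p) (v : DefiningVector p) :
    rot k * syl l v = syl (l + k) v * rot k := by
  simp only [syl, add_comm l k, rot_add, rot_neg]
  group

/-! ### Words in syllables and their sections. -/

/-- The element represented by a list of syllables. -/
def evalWord {p : ℕ} {W : Submodule (ZMod p) (DefiningVector p)} (L : List (ZMod p × W)) :
    TreeAut (ZMod p) := (L.map fun s => syl s.1 s.2.1).prod

/-- `HasWord W n g k v` says that `g` is a product of at most `n` syllables over `W` with total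
vector `v`, times `rot k`. -/
def HasWord {p : ℕ} (W : Submodule (ZMod p) (DefiningVector p)) (n : ℕ) (g : TreeAut (ZMod p))
    (k : ZMod p) (v : W) : Prop :=
  ∃ L : List (ZMod p × W), L.length ≤ n ∧ g = evalWord L * rot k ∧ (L.map Prod.snd).sum = v

theorem rot_mul_evalWord {p : ℕ} {W : Submodule (ZMod p) (DefiningVector p)} (k : ZMod p)
    (L : List (ZMod p × W)) :
    rot k * evalWord L = evalWord (L.map fun s => (s.1 + k, s.2)) * rot k := by
  induction L with
  | nil => simp [evalWord]
  | cons s L ih =>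
    simp only [evalWord, List.map_cons, List.prod_cons] at ih ⊢
    rw [← mul_assoc, rot_mul_syl, mul_assoc, ih, mul_assoc]

namespace HasWord

theorem mono {p : ℕ} {W : Submodule (ZMod p) (DefiningVector p)} {n m : ℕ} {g : TreeAut (ZMod p)}
    {k : ZMod p} {v : W} (h : HasWord W n g k v) (hnm : n ≤ m) : HasWord W m g k v := by
  obtain ⟨L, h1, h2, h3⟩ := h
  exact ⟨L, h1.trans hnm, h2, h3⟩

theorem of_rot {p : ℕ} (W : Submodule (ZMod p) (DefiningVector p)) (k : ZMod p) :
    HasWord W 0 (rot k) k 0 := ⟨[], le_rfl, by simp [evalWord], rfl⟩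

theorem one {p : ℕ} (W : Submodule (ZMod p) (DefiningVector p)) : HasWord W 0 1 0 0 := by
  simpa using of_rot W 0

theorem of_syl {p : ℕ} {W : Submodule (ZMod p) (DefiningVector p)} (k : ZMod p) (v : W) :
    HasWord W 1 (syl k v.1) 0 v := ⟨[(k, v)], le_rfl, by simp [evalWord], by simp⟩

theorem of_spinalB {p : ℕ} {W : Submodule (ZMod p) (DefiningVector p)} (v : W) :
    HasWord W 1 (spinalB v.1) 0 v := by
  simpa [syl_zero_left] using of_syl 0 v

theorem mul {p : ℕ} {W : Submodule (ZMod p) (DefiningVector p)} {n m : ℕ} {g h : TreeAut (ZMod p)}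
    {k l : ZMod p} {v w : W} (hg : HasWord W n g k v) (hh : HasWord W m h l w) :
    HasWord W (n + m) (g * h) (k + l) (v + w) := by
  obtain ⟨L, h1, rfl, rfl⟩ := hg
  obtain ⟨L', h1', rfl, rfl⟩ := hh
  refine ⟨L ++ L'.map fun s => (s.1 + k, s.2), by simp; omega, ?_, ?_⟩
  · rw [rot_add, mul_assoc (evalWord L), ← mul_assoc (rot k), rot_mul_evalWord]
    simp only [evalWord, List.map_append, List.prod_append, mul_assoc]
  · simp [Function.comp_def]

theorem inv {p : ℕ} [NeZero p] {W : Submodule (ZMod p) (DefiningVector p)} {n : ℕ}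
    {g : TreeAut (ZMod p)} {k : ZMod p} {v : W} (hg : HasWord W n g k v) :
    HasWord W n g⁻¹ (-k) (-v) := by
  obtain ⟨L, h1, rfl, rfl⟩ := hg
  have key : HasWord W L.length (evalWord L)⁻¹ 0 (-(L.map Prod.snd).sum) := by
    clear h1
    induction L with
    | nil => simpa [evalWord] using one W
    | cons s L ih =>
      have h : (syl s.1 s.2.1)⁻¹ = syl s.1 (-s.2).1 := by
        rw [inv_eq_iff_mul_eq_one, ← syl_add]
        simp [syl_zero_right]
      have h2 := ih.mul (of_syl s.1 (-s.2))
      simp only [evalWord, List.map_cons, List.prod_cons, mul_inv_rev, List.sum_cons, neg_add_rev,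
        List.length_cons, h] at h2 ⊢
      simpa using h2
  have := (of_rot W (-k)).mul key
  rw [mul_inv_rev, ← rot_neg]
  simpa using this.mono (by omega : 0 + L.length ≤ n)

theorem act_eq {p : ℕ} {W : Submodule (ZMod p) (DefiningVector p)} {n : ℕ} {g : TreeAut (ZMod p)}
    {k : ZMod p} {v : W} (h : HasWord W n g k v) (x : ZMod p) : act g x = x + k := by
  obtain ⟨L, -, rfl, -⟩ := h
  have : ∀ y, act (evalWord L) y = y := by
    intro y
    induction L with
    | nil => simp [evalWord]
    | cons s L ih =>
      simp only [evalWord, List.map_cons, List.prod_cons] at ih ⊢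
      rw [act_mul, ih, act_syl]
  rw [act_mul, act_rot, this]

end HasWord

/-- The data of the section at a first-level vertex of an element represented by a word. -/
structure SectData {p : ℕ} [NeZero p] (W : Submodule (ZMod p) (DefiningVector p)) (n : ℕ)
    (g : TreeAut (ZMod p)) (k : ZMod p) (v : W) where
  /-- the numbers of syllables of the sections -/
  cnt : ZMod p → ℕ
  /-- the rooted parts of the sections -/
  rt : ZMod p → ZMod p
  /-- the total vectors of the sections -/
  vec : ZMod p → W
  rep : ∀ x, HasWord W (cnt x) (sect g x) (rt x) (vec x)
  sum_cnt : ∑ x, cnt x ≤ n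
  sum_rt : ∑ x, rt x = coordSum v.1
  sum_vec : ∑ x, vec x = v
  single : ∀ x, (∀ y, y ≠ x → cnt y = 0) → g = syl (x + k) v.1 * rot k

/-- A syllable at `s` puts one syllable into the section at `s` and only rotations into the others,
so prepending it changes the counts at one letter. The final `rot k` merely shifts the letters. -/
theorem HasWord.exists_sectData {p : ℕ} [NeZero p] {W : Submodule (ZMod p) (DefiningVector p)} {n : ℕ}
    {g : TreeAut (ZMod p)} {k : ZMod p} {v : W} (h : HasWord W n g k v) :
    Nonempty (SectData W n g k v) := by
  obtain ⟨L, hn, rfl, rfl⟩ := h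
  have key : Nonempty (SectData W L.length (evalWord L) 0 (L.map Prod.snd).sum) := by
    clear hn
    induction L with
    | nil =>
      exact ⟨⟨fun _ => 0, fun _ => 0, fun _ => 0, fun x => by simpa [evalWord] using one W, by simp,
        by simp [coordSum_zero], by simp, fun x _ => by simp [evalWord, syl_zero_right]⟩⟩
    | cons s L ih =>
      obtain ⟨D⟩ := ih
      have hact : ∀ y, act (evalWord L) y = y := fun y => by
        have : HasWord W L.length (evalWord L) 0 (L.map Prod.snd).sum := ⟨L, le_rfl, by simp, rfl⟩
        simpa using this.act_eq y
      refine ⟨⟨fun x => (if x = s.1 then 1 else 0) + D.cnt x,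
        fun x => coord s.2.1 (x - s.1) + D.rt x,
        fun x => (if x = s.1 then s.2 else 0) + D.vec x, fun x => ?_, ?_, ?_, ?_, fun x hx => ?_⟩⟩
      · have h1 : sect (evalWord (s :: L)) x = sect (syl s.1 s.2.1) x * sect (evalWord L) x := by
          simp only [evalWord, List.map_cons, List.prod_cons] at hact ⊢
          rw [sect_mul, hact]
        rw [h1]
        refine HasWord.mul ?_ (D.rep x)
        split_ifs with hx
        · rw [hx, sect_syl_self, sub_self, coord_zero_right]
          exact of_spinalB s.2
        · rw [sect_syl hx]
          exact of_rot W _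
      · rw [Finset.sum_add_distrib]
        have := D.sum_cnt
        simp
        omega
      · rw [Finset.sum_add_distrib, D.sum_rt]
        simp only [List.map_cons, List.sum_cons, Submodule.coe_add, coordSum_add]
        congr 1
        -- The letter `s.1` contributes the coordinate at `0`, which is `0` by convention, so the
        -- sum runs over all letters.
        exact (Equiv.subRight s.1).sum_comp fun x => coord s.2.1 x
      · rw [Finset.sum_add_distrib, D.sum_vec]
        simp
      · have h1 : s.1 = x := by
          by_contra hne
          have := hx s.1 hne
          simp at this
        have h2 := D.single x fun y hy => by
          have := hx y hy
          omega
        simp only [rot_zero, mul_one, add_zero] at h2 ⊢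
        simp only [List.map_cons, List.sum_cons, Submodule.coe_add, syl_add]
        rw [← h2, ← h1]
        simp [evalWord]
  obtain ⟨D⟩ := key
  have hs : ∀ x, sect (evalWord L * rot k) x = sect (evalWord L) (x + k) := fun x => by
    simp [sect_mul]
  refine ⟨⟨fun x => D.cnt (x + k), fun x => D.rt (x + k), fun x => D.vec (x + k), fun x => ?_,
    ?_, ?_, ?_, fun x hx => ?_⟩⟩
  · rw [hs]
    exact D.rep _
  · exact (Equiv.sum_comp (Equiv.addRight k) D.cnt).le.trans (D.sum_cnt.trans hn)
  · exact (Equiv.sum_comp (Equiv.addRight k) D.rt).trans D.sum_rt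
  · exact (Equiv.sum_comp (Equiv.addRight k) D.vec).trans D.sum_vec
  · congr 1
    have := D.single (x + k) fun y hy => by
      have := hx (y - k) fun h => hy (by rw [← h]; ring)
      simpa using this
    simpa using this

/-! ### The spinal group of a space of vectors and its self-similarity. -/

/-- The group generated by the rooted automorphisms and the directed automorphisms `spinalB v`,
`v ∈ W`. -/
def spinalGroup {p : ℕ} [NeZero p] (W : Submodule (ZMod p) (DefiningVector p)) :
    Subgroup (TreeAut (ZMod p)) where
  carrier := {g | ∃ n k v, HasWord W n g k v}
  one_mem' := ⟨0, 0, 0, .one W⟩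
  mul_mem' := by
    rintro _ _ ⟨n, k, v, h⟩ ⟨m, l, w, h'⟩
    exact ⟨_, _, _, h.mul h'⟩
  inv_mem' := by
    rintro _ ⟨n, k, v, h⟩
    exact ⟨_, _, _, h.inv⟩

section
variable {p : ℕ} [Fact p.Prime] {W : Submodule (ZMod p) (DefiningVector p)}

theorem HasWord.mem {n : ℕ} {g : TreeAut (ZMod p)} {k : ZMod p} {v : W} (h : HasWord W n g k v) :
    g ∈ spinalGroup W := ⟨n, k, v, h⟩

theorem rot_mem_spinalGroup (W : Submodule (ZMod p) (DefiningVector p)) (k : ZMod p) :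
    rot k ∈ spinalGroup W := (HasWord.of_rot W k).mem

theorem syl_mem_spinalGroup (k : ZMod p) (v : W) : syl k v.1 ∈ spinalGroup W :=
  (HasWord.of_syl k v).mem

theorem spinalB_mem_spinalGroup (v : W) : spinalB v.1 ∈ spinalGroup W :=
  (HasWord.of_spinalB v).mem

theorem spinalGroup_le {M : Subgroup (TreeAut (ZMod p))} (h1 : ∀ k, rot k ∈ M)
    (h2 : ∀ v : W, spinalB v.1 ∈ M) : spinalGroup W ≤ M := by
  rintro _ ⟨n, k, v, L, -, rfl, -⟩
  refine M.mul_mem (M.list_prod_mem ?_) (h1 k)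
  simp only [List.mem_map]
  rintro _ ⟨s, -, rfl⟩
  exact M.mul_mem (M.mul_mem (h1 _) (h2 _)) (h1 _)

theorem multiEdgeSpinalGroup_eq {r : ℕ} (E : Fin r → DefiningVector p) :
    multiEdgeSpinalGroup E = spinalGroup (Submodule.span (ZMod p) (Set.range E)) := by
  apply le_antisymm
  · rw [multiEdgeSpinalGroup, Subgroup.closure_le]
    rintro _ (h | ⟨i, rfl⟩)
    · rw [Set.mem_singleton_iff.mp h, ← rot_one]
      exact rot_mem_spinalGroup _ _
    · have hi : E i ∈ Submodule.span (ZMod p) (Set.range E) :=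
        Submodule.subset_span (Set.mem_range_self i)
      exact spinalB_mem_spinalGroup ⟨E i, hi⟩
  · have hA : spinalA p ∈ multiEdgeSpinalGroup E :=
      Subgroup.subset_closure (Set.mem_union_left _ rfl)
    have hB : ∀ i, spinalB (E i) ∈ multiEdgeSpinalGroup E := fun i =>
      Subgroup.subset_closure (Set.mem_union_right _ (Set.mem_range_self i))
    refine spinalGroup_le (fun k => ?_) ?_
    · rw [rot_eq_pow]
      exact Subgroup.pow_mem _ hA _
    · rintro ⟨v, hv⟩
      change spinalB v ∈ _
      induction hv using Submodule.span_induction with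
      | mem v hv =>
        obtain ⟨i, rfl⟩ := hv
        exact hB i
      | zero =>
        rw [spinalB_zero]
        exact Subgroup.one_mem _
      | add v w _ _ hv hw =>
        rw [spinalB_add]
        exact Subgroup.mul_mem _ hv hw
      | smul c v _ hv =>
        have : c • v = c.val • v := by
          conv_lhs => rw [← ZMod.natCast_zmod_val c]
          rw [Nat.cast_smul_eq_nsmul]
        rw [this, spinalB_nsmul]
        exact Subgroup.pow_mem _ hv _

theorem act_eq_of_mem {g : TreeAut (ZMod p)} (hg : g ∈ spinalGroup W) :
    ∃ k, ∀ x, act g x = x + k := by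
  obtain ⟨n, k, v, h⟩ := hg
  exact ⟨k, h.act_eq⟩

theorem mem_levelStab_of_mem {g : TreeAut (ZMod p)} (hg : g ∈ spinalGroup W) {x : ZMod p}
    (hx : act g x = x) : g ∈ levelStab (ZMod p) := by
  obtain ⟨k, hk⟩ := act_eq_of_mem hg
  have : k = 0 := by simpa [hx] using hk x
  intro y
  simp [hk, this]

theorem sect_mem_spinalGroup {g : TreeAut (ZMod p)} (hg : g ∈ spinalGroup W) (x : ZMod p) :
    sect g x ∈ spinalGroup W := by
  obtain ⟨n, k, v, h⟩ := hg
  obtain ⟨D⟩ := h.exists_sectData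
  exact (D.rep x).mem

theorem sectGroup_le {M : Subgroup (TreeAut (ZMod p))} (hM : M ≤ spinalGroup W) (x : ZMod p) :
    sectGroup M x ≤ spinalGroup W := by
  rintro _ ⟨m, hm, -, rfl⟩
  exact sect_mem_spinalGroup (hM hm) x

/-- At `x`, the syllables based at `x` give all directed generators, and a syllable based at `x - j`
with a nonzero `j`-th coordinate gives a nontrivial rotation, hence all of them. -/
theorem sectGroup_spinalGroup (hW : W ≠ ⊥) (x : ZMod p) :
    sectGroup (spinalGroup W) x = spinalGroup W := by
  apply le_antisymm (sectGroup_le le_rfl x)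
  obtain ⟨v, hv, hv0⟩ := W.ne_bot_iff.mp hW
  obtain ⟨j, hj, hvj⟩ := exists_coord_ne_zero hv0
  refine spinalGroup_le (rot_mem_of_rot_mem hvj ?_) fun v => ?_
  · have := sect_mem_sectGroup (syl_mem_spinalGroup (x - j) ⟨v, hv⟩) (act_syl (x - j) x v)
    rwa [sect_syl fun h => hj (sub_eq_self.mp h.symm), sub_sub_cancel] at this
  · have := sect_mem_sectGroup (syl_mem_spinalGroup x v) (act_syl x x v.1)
    rwa [sect_syl_self] at this

/-- A word either reduces to a single syllable, or all its sections are shorter. -/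
theorem SectData.single_or_lt {n : ℕ} {g : TreeAut (ZMod p)} {k : ZMod p} {v : W}
    (D : SectData W n g k v) : (∃ x, g = syl (x + k) v.1 * rot k) ∨ ∀ x, D.cnt x < n := by
  by_cases h : ∃ x, ∀ y, y ≠ x → D.cnt y = 0
  · obtain ⟨x, hx⟩ := h
    exact Or.inl ⟨x, D.single x hx⟩
  · push Not at h
    refine Or.inr fun x => ?_
    obtain ⟨y, hy, h0⟩ := h x
    have h1 := Finset.add_le_sum (f := D.cnt) (fun _ _ => Nat.zero_le _) (Finset.mem_univ y)
      (Finset.mem_univ x) hy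
    have := D.sum_cnt
    omega

/-! ### Torsion. -/

theorem sum_range_add_mul {A : Type*} [AddCommMonoid A] (f : ZMod p → A) (x : ZMod p) {k : ZMod p}
    (hk : k ≠ 0) : ∑ i ∈ Finset.range p, f (x + i * k) = ∑ y, f y := by
  refine Finset.sum_nbij' (fun i => x + i * k) (fun y => ((y - x) * k⁻¹).val) (by simp)
    (fun y _ => by simpa using ZMod.val_lt _) (fun i hi => ?_) (fun y _ => ?_) (by simp)
  · rw [add_sub_cancel_left, mul_inv_cancel_right₀ hk, ZMod.val_cast_of_lt (by simpa using hi)]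
  · rw [ZMod.natCast_zmod_val, inv_mul_cancel_right₀ hk]
    ring

/-- The orbit `x + i * k` visits every letter once, so the section of `g ^ p` at `x` is a product of
all the sections of `g`. Its length, rotation and vector are the sums over all letters. -/
theorem HasWord.pow_prime {n : ℕ} {g : TreeAut (ZMod p)} {k : ZMod p} {v : W}
    (h : HasWord W n g k v) (hk : k ≠ 0) (x : ZMod p) :
    act (g ^ p) x = x ∧ HasWord W n (sect (g ^ p) x) (coordSum v.1) v := by
  obtain ⟨D⟩ := h.exists_sectData
  have key : ∀ m : ℕ, act (g ^ m) x = x + m * k ∧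
      HasWord W (∑ i ∈ Finset.range m, D.cnt (x + i * k)) (sect (g ^ m) x)
        (∑ i ∈ Finset.range m, D.rt (x + i * k)) (∑ i ∈ Finset.range m, D.vec (x + i * k)) := by
    intro m
    induction m with
    | zero => simpa using HasWord.one W
    | succ m ih =>
      rw [pow_succ', act_mul, sect_mul, ih.1, h.act_eq]
      refine ⟨by push_cast; ring, ?_⟩
      have := (D.rep (x + m * k)).mul ih.2
      rw [Finset.sum_range_succ_comm, Finset.sum_range_succ_comm, Finset.sum_range_succ_comm]
      exact this
  have h2 := key p
  rw [sum_range_add_mul _ x hk, sum_range_add_mul _ x hk, sum_range_add_mul _ x hk, D.sum_rt,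
    D.sum_vec] at h2
  exact ⟨by simpa using h2.1, h2.2.mono D.sum_cnt⟩

theorem act_pow_sect_pow {X : Type*} {g : TreeAut X} {x : X} (h : act g x = x) (m : ℕ) :
    act (g ^ m) x = x ∧ sect (g ^ m) x = sect g x ^ m := by
  induction m with
  | zero => simp
  | succ m ih => rw [pow_succ, act_mul, sect_mul, h, ih.1, ih.2, pow_succ]; exact ⟨rfl, rfl⟩

/-- The section of `g ^ p` has the same vector and the nonzero rotation `coordSum v`, so the
argument repeats. An exponent killing `g` would be divisible by `p`, and its quotient by `p` would
kill that section: an infinite descent. -/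
theorem HasWord.not_isOfFinOrder {n : ℕ} {g : TreeAut (ZMod p)} {k : ZMod p} {v : W}
    (h : HasWord W n g k v) (hk : k ≠ 0) (hs : coordSum v.1 ≠ 0) : ¬ IsOfFinOrder g := by
  rw [isOfFinOrder_iff_pow_eq_one]
  rintro ⟨N, hN, hg⟩
  induction N using Nat.strong_induction_on generalizing g k with
  | _ N ih =>
    have hact : ∀ m : ℕ, act (g ^ m) 0 = m * k := by
      intro m
      induction m with
      | zero => simp
      | succ m ih => rw [pow_succ', act_mul, ih, h.act_eq]; push_cast; ring
    have h0 := hact N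
    rw [hg, act_one] at h0
    have hNp : (N : ZMod p) = 0 := by simpa [hk] using h0.symm
    obtain ⟨M, rfl⟩ := (ZMod.natCast_eq_zero_iff _ _).mp hNp
    obtain ⟨h1, h2⟩ := h.pow_prime hk 0
    have hM : 0 < M := Nat.pos_of_mul_pos_left hN
    refine ih M (lt_mul_of_one_lt_left hM (Fact.out : p.Prime).one_lt) h2 hs hM ?_
    rw [← (act_pow_sect_pow h1 M).2, ← pow_mul, hg, sect_one]

theorem isOfFinOrder_of_sect {X : Type*} [Fintype X] {g : TreeAut X} (h1 : ∀ x, act g x = x)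
    (h2 : ∀ x, IsOfFinOrder (sect g x)) : IsOfFinOrder g := by
  rw [isOfFinOrder_iff_pow_eq_one]
  refine ⟨∏ x, orderOf (sect g x), Finset.prod_pos fun x _ => (h2 x).orderOf_pos, ?_⟩
  refine treeAut_ext (fun x => ?_) fun x => ?_
  · rw [(act_pow_sect_pow (h1 x) _).1, act_one]
  · rw [(act_pow_sect_pow (h1 x) _).2, sect_one]
    exact orderOf_dvd_iff_pow_eq_one.mp (Finset.dvd_prod_of_mem _ (Finset.mem_univ x))

theorem isOfFinOrder_syl (k : ZMod p) (v : DefiningVector p) : IsOfFinOrder (syl k v) := by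
  have h : ∀ n : ℕ, syl k (n • v) = syl k v ^ n := by
    intro n
    induction n with
    | zero => simp [syl_zero_right]
    | succ n ih => rw [succ_nsmul, syl_add, ih, pow_succ]
  refine isOfFinOrder_iff_pow_eq_one.mpr ⟨p, (Fact.out : p.Prime).pos, ?_⟩
  have : p • v = 0 := by ext; simp
  rw [← h, this, syl_zero_right]

/-- Induction on length. Sections of an element fixing the first level are shorter unless it is a
single syllable, which has finite order. If the rotation is nontrivial, the sections of `g ^ p` are
no longer than `g` and have rotation `coordSum v = 0`, which is the previous case. -/
theorem isOfFinOrder_of_mem (hs : ∀ v ∈ W, coordSum v = 0) {g : TreeAut (ZMod p)}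
    (hg : g ∈ spinalGroup W) : IsOfFinOrder g := by
  obtain ⟨n, k, v, h⟩ := hg
  induction n using Nat.strong_induction_on generalizing g k v with
  | _ n ih =>
    have key : ∀ g : TreeAut (ZMod p), ∀ v : W, HasWord W n g 0 v → IsOfFinOrder g := by
      intro g v h
      obtain ⟨D⟩ := h.exists_sectData
      rcases D.single_or_lt with ⟨x, hx⟩ | hlt
      · rw [hx, rot_zero, mul_one]
        exact isOfFinOrder_syl _ _
      · exact isOfFinOrder_of_sect (fun x => by simp [h.act_eq])
          fun x => ih _ (hlt x) _ _ (D.rep x)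
    by_cases hk : k = 0
    · exact key g v (hk ▸ h)
    · have hp : IsOfFinOrder (g ^ p) := isOfFinOrder_of_sect (fun x => (h.pow_prime hk x).1)
        fun x => key _ v (by simpa [hs v v.2] using (h.pow_prime hk x).2)
      exact hp.of_pow (Fact.out : p.Prime).ne_zero

end

/-! ### Dense subgroups and their section groups. -/

/-- `M` is a subgroup of `G` that is dense in the profinite topology of `G`. -/
structure DenseIn {Γ : Type*} [Group Γ] (G M : Subgroup Γ) : Prop where
  le : M ≤ G
  exists_mem : ∀ N : Subgroup Γ, N.relIndex G ≠ 0 → ∀ g ∈ G, ∃ m ∈ M, g⁻¹ * m ∈ N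

theorem map_conj_eq_self {Γ : Type*} [Group Γ] {G : Subgroup Γ} {g : Γ} (hg : g ∈ G) :
    G.map (MulAut.conj g).toMonoidHom = G := Subgroup.conj_smul_eq_self_of_mem hg

theorem DenseIn.conj {Γ : Type*} [Group Γ] {G M : Subgroup Γ} (h : DenseIn G M) {g : Γ}
    (hg : g ∈ G) : DenseIn G (M.map (MulAut.conj g).toMonoidHom) := by
  refine ⟨?_, fun N hN f hf => ?_⟩
  · rw [← map_conj_eq_self hg]
    exact Subgroup.map_mono h.le
  · obtain ⟨m, hm, hmN⟩ := h.exists_mem (N.comap (MulAut.conj g).toMonoidHom)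
      (by rwa [Subgroup.relIndex_comap, map_conj_eq_self hg]) (g⁻¹ * f * g)
      (G.mul_mem (G.mul_mem (G.inv_mem hg) hf) hg)
    refine ⟨_, Subgroup.mem_map_of_mem _ hm, ?_⟩
    simpa [mul_assoc] using hmN

theorem eq_of_map_conj_eq {Γ : Type*} [Group Γ] {G M : Subgroup Γ} {g : Γ} (hg : g ∈ G)
    (h : M.map (MulAut.conj g).toMonoidHom = G) : M = G := by
  conv_rhs at h => rw [← map_conj_eq_self hg]
  exact Subgroup.map_injective (MulAut.conj g).injective h

theorem DenseIn.eq_of_relIndex_ne_zero {Γ : Type*} [Group Γ] {G M N : Subgroup Γ}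
    (h : DenseIn G M) (hN : N.relIndex G ≠ 0) (hNM : N ≤ M) : M = G := by
  refine le_antisymm h.le fun g hg => ?_
  obtain ⟨m, hm, hmN⟩ := h.exists_mem N hN g hg
  have := M.mul_mem hm (M.inv_mem (hNM hmN))
  simpa using this

theorem relIndex_map_ne_zero {Γ Δ : Type*} [Group Γ] [Group Δ] (f : Γ →* Δ) {H K : Subgroup Γ}
    (h : H.relIndex K ≠ 0) : (H.map f).relIndex (K.map f) ≠ 0 := by
  rw [← Subgroup.relIndex_comap]
  exact mt (Subgroup.relIndex_eq_zero_of_le_left (Subgroup.le_comap_map f H)) h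

theorem relIndex_ne_zero_of_index {Γ : Type*} [Group Γ] {H : Subgroup Γ} (K : Subgroup Γ)
    (h : H.index ≠ 0) : H.relIndex K ≠ 0 := mt Subgroup.index_eq_zero_of_relIndex_eq_zero h

theorem length_apply {X : Type*} (f : TreeAut X) (w : List X) : (f.1 w).length = w.length := by
  induction w generalizing f with
  | nil => rw [apply_nil]
  | cons x w ih => rw [apply_cons]; simp [ih]

theorem index_stabilizer_ne_zero {X : Type*} [Finite X] (w : List X) :
    (MulAction.stabilizer (TreeAut X) w).index ≠ 0 := by
  rw [MulAction.index_stabilizer]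
  have hfin : (MulAction.orbit (TreeAut X) w).Finite := by
    refine (List.finite_length_eq X w.length).subset ?_
    rintro _ ⟨f, rfl⟩
    exact length_apply f w
  exact (Set.ncard_pos hfin).mpr (MulAction.nonempty_orbit w) |>.ne'

theorem mem_stabilizer_word {X : Type*} {w : List X} {f : TreeAut X} :
    f ∈ MulAction.stabilizer (TreeAut X) w ↔ f.1 w = w := Iff.rfl

theorem exists_index_ne_zero_notMem {X : Type*} [Finite X] {f : TreeAut X} (hf : f ≠ 1) :
    ∃ N : Subgroup (TreeAut X), N.index ≠ 0 ∧ f ∉ N := by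
  have : ∃ w, f.1 w ≠ w := by
    by_contra! h
    exact hf (Subtype.ext (Equiv.ext h))
  obtain ⟨w, hw⟩ := this
  exact ⟨_, index_stabilizer_ne_zero w, fun h => hw (mem_stabilizer_word.mp h)⟩

/-- The elements of the first-level stabilizer whose section at `x` lies in `N`. -/
def sectPreimage {X : Type*} (N : Subgroup (TreeAut X)) (x : X) : Subgroup (TreeAut X) :=
  (N.comap (sectHom x)).map (levelStab X).subtype

theorem mem_sectPreimage {X : Type*} {N : Subgroup (TreeAut X)} {x : X} {f : TreeAut X} :
    f ∈ sectPreimage N x ↔ f ∈ levelStab X ∧ sect f x ∈ N := by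
  constructor
  · rintro ⟨f, hf, rfl⟩
    exact ⟨f.2, hf⟩
  · rintro ⟨h1, h2⟩
    exact ⟨⟨f, h1⟩, h2, rfl⟩

section
variable {p : ℕ} [Fact p.Prime] {W : Submodule (ZMod p) (DefiningVector p)}

/-- The group acts on the first level by translations, so fixing one letter means fixing all. -/
theorem relIndex_levelStab_ne_zero : (levelStab (ZMod p)).relIndex (spinalGroup W) ≠ 0 := by
  have h := relIndex_ne_zero_of_index (spinalGroup W) (index_stabilizer_ne_zero [(0 : ZMod p)])
  rw [← Subgroup.inf_relIndex_right] at h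
  refine mt (Subgroup.relIndex_eq_zero_of_le_left ?_) h
  rintro f ⟨h1, h2⟩
  refine mem_levelStab_of_mem h2 (x := 0) ?_
  have := mem_stabilizer_word.mp h1
  rw [apply_singleton] at this
  simpa using this

theorem map_sectHom {M : Subgroup (TreeAut (ZMod p))} (hM : M ≤ spinalGroup W) (x : ZMod p) :
    (M.subgroupOf (levelStab (ZMod p))).map (sectHom x) = sectGroup M x := by
  ext g
  constructor
  · rintro ⟨m, hm, rfl⟩
    exact ⟨m, hm, m.2 x, rfl⟩
  · rintro ⟨m, hm, h, rfl⟩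
    exact ⟨⟨m, mem_levelStab_of_mem (hM hm) h⟩, hm, rfl⟩

theorem relIndex_sectPreimage_ne_zero {N : Subgroup (TreeAut (ZMod p))} (x : ZMod p)
    (hN : N.relIndex (spinalGroup W) ≠ 0) :
    (sectPreimage N x).relIndex (spinalGroup W) ≠ 0 := by
  refine Subgroup.relIndex_ne_zero_trans (K := levelStab (ZMod p) ⊓ spinalGroup W) ?_ ?_
  · have h1 : (N.comap (sectHom x)).relIndex
        ((spinalGroup W).subgroupOf (levelStab (ZMod p))) ≠ 0 := by
      rw [Subgroup.relIndex_comap, map_sectHom le_rfl]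
      exact mt (Subgroup.relIndex_eq_zero_of_le_right (sectGroup_le le_rfl x)) hN
    have h2 := relIndex_map_ne_zero (levelStab (ZMod p)).subtype h1
    rwa [Subgroup.subgroupOf_map_subtype, inf_comm] at h2
  · rw [Subgroup.inf_relIndex_right]
    exact relIndex_levelStab_ne_zero

theorem DenseIn.exists_act_eq {M : Subgroup (TreeAut (ZMod p))} (h : DenseIn (spinalGroup W) M)
    (x y : ZMod p) : ∃ m ∈ M, act m x = y := by
  obtain ⟨m, hm, hN⟩ := h.exists_mem _
    (relIndex_ne_zero_of_index _ (index_stabilizer_ne_zero [x])) _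
    (rot_mem_spinalGroup W (y - x))
  refine ⟨m, hm, ?_⟩
  have := mem_stabilizer_word.mp hN
  rw [apply_singleton] at this
  have h2 : act ((rot (y - x))⁻¹ * m) x = x := by simpa using this
  rw [act_mul, ← rot_neg, act_rot] at h2
  linear_combination h2

/-- Lift `g` to an element of the group fixing `x` and approximate the lift in `M` modulo the
finite-index subgroup `sectPreimage N x`; the section of the approximation is the required element.
-/
theorem DenseIn.sectGroup (hW : W ≠ ⊥) {M : Subgroup (TreeAut (ZMod p))}
    (h : DenseIn (spinalGroup W) M) (x : ZMod p) :
    DenseIn (spinalGroup W) (sectGroup M x) := by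
  refine ⟨sectGroup_le h.le x, fun N hN g hg => ?_⟩
  rw [← sectGroup_spinalGroup hW x] at hg
  obtain ⟨f, hf, hfx, rfl⟩ := hg
  obtain ⟨m, hm, hmN⟩ := h.exists_mem _ (relIndex_sectPreimage_ne_zero x hN) f hf
  obtain ⟨h1, h2⟩ := mem_sectPreimage.mp hmN
  have hmx : act m x = x := by
    have h3 := h1 x
    rw [act_mul] at h3
    have h4 := act_act_inv f (act m x)
    rw [h3, hfx] at h4
    exact h4.symm
  refine ⟨_, sect_mem_sectGroup hm hmx, ?_⟩
  rw [sect_mul, hmx] at h2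
  have h3 := sect_inv f x
  rw [hfx] at h3
  rwa [h3] at h2

/-- Elements with prescribed total vector are found in every dense subgroup. -/
theorem DenseIn.exists_hasWord {M : Subgroup (TreeAut (ZMod p))} (h : DenseIn (spinalGroup W) M)
    (k : ZMod p) (v : W) : ∃ m ∈ M, ∃ n, HasWord W n m k v := by
  -- `N` has finite index because the finitely many elements `spinalB v * rot k` represent all its
  -- cosets. Uniqueness of the total vector of an element is not needed.
  let N : Subgroup (TreeAut (ZMod p)) :=
    { carrier := {g | ∃ n, HasWord W n g 0 0}
      one_mem' := ⟨0, .one W⟩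
      mul_mem' := by
        rintro _ _ ⟨n, h⟩ ⟨m, h'⟩
        exact ⟨_, by simpa using h.mul h'⟩
      inv_mem' := by
        rintro _ ⟨n, h⟩
        exact ⟨_, by simpa using h.inv⟩ }
  have hN : N.relIndex (spinalGroup W) ≠ 0 := by
    have hsurj : Function.Surjective fun q : ZMod p × W =>
        (QuotientGroup.mk (⟨spinalB q.2.1 * rot q.1, (spinalGroup W).mul_mem
          (spinalB_mem_spinalGroup q.2) (rot_mem_spinalGroup W q.1)⟩ : spinalGroup W) :
          spinalGroup W ⧸ N.subgroupOf (spinalGroup W)) := by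
      intro q
      obtain ⟨⟨g, n, k, v, hg⟩, rfl⟩ := QuotientGroup.mk_surjective q
      refine ⟨(k, v), QuotientGroup.eq.mpr ?_⟩
      exact ⟨_, by simpa using ((HasWord.of_spinalB v).mul (.of_rot W k)).inv.mul hg⟩
    have := Finite.of_surjective _ hsurj
    exact (Subgroup.finiteIndex_of_finite_quotient).index_ne_zero
  obtain ⟨m, hm, n, hmN⟩ := h.exists_mem N hN (spinalB v.1 * rot k) ((spinalGroup W).mul_mem
    (spinalB_mem_spinalGroup v) (rot_mem_spinalGroup W k))
  refine ⟨m, hm, 1 + 0 + n, ?_⟩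
  have hw := ((HasWord.of_spinalB v).mul (.of_rot W k)).mul hmN
  rw [mul_inv_cancel_left] at hw
  simpa using hw

theorem group_fg_spinalGroup : Group.FG (spinalGroup W) := by
  rw [Group.fg_iff_subgroup_fg, Subgroup.fg_iff]
  refine ⟨Set.range rot ∪ Set.range fun v : W => spinalB v.1, le_antisymm ?_ ?_,
    (Set.finite_range _).union (Set.finite_range _)⟩
  · rw [Subgroup.closure_le]
    rintro _ (⟨k, rfl⟩ | ⟨v, rfl⟩)
    · exact rot_mem_spinalGroup W k
    · exact spinalB_mem_spinalGroup v
  · exact spinalGroup_le (fun k => Subgroup.subset_closure (Set.mem_union_left _ ⟨k, rfl⟩))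
      fun v => Subgroup.subset_closure (Set.mem_union_right _ (Set.mem_range_self v))

/-- An infinite torsion spinal group is not virtually abelian. -/
theorem not_virtually_abelian (hs : ∀ v ∈ W, coordSum v = 0) [Infinite (spinalGroup W)]
    {A : Subgroup (TreeAut (ZMod p))} (hA : A.relIndex (spinalGroup W) ≠ 0)
    (hcomm : ∀ a ∈ A, ∀ b ∈ A, a * b = b * a) : False := by
  let B := A.subgroupOf (spinalGroup W)
  have hB : B.FiniteIndex := ⟨hA⟩
  have := group_fg_spinalGroup (W := W)
  have hfg : Group.FG B := inferInstance
  let _ : CommGroup B :=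
    { (inferInstance : Group B) with
      mul_comm := fun a b => Subtype.ext (Subtype.ext (hcomm _ a.2 _ b.2)) }
  have htor : IsMulTorsion B := by
    intro b
    have h1 := isOfFinOrder_of_mem hs b.1.2
    have h2 : Function.Injective ((spinalGroup W).subtype.comp B.subtype) :=
      (Subtype.val_injective).comp Subtype.val_injective
    exact (h2.isOfFinOrder_iff (f := (spinalGroup W).subtype.comp B.subtype)).mp h1
  have hfin : Finite B := CommGroup.finite_of_fg_isMulTorsion B htor
  have h := B.card_mul_index
  have h0 : Nat.card (spinalGroup W) = 0 := Nat.card_eq_zero_of_infinite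
  rw [h0, mul_eq_zero] at h
  rcases h with h | h
  · exact Nat.card_pos.ne' h
  · exact hA h

end

/-! ### Ascent: from a full section group to the full group. -/

open scoped commutatorElement

theorem sect_commutator {X : Type*} {f g : TreeAut X} (hf : f ∈ levelStab X) (hg : g ∈ levelStab X)
    (x : X) : sect ⁅f, g⁆ x = ⁅sect f x, sect g x⁆ :=
  map_commutatorElement (sectHom x) ⟨f, hf⟩ ⟨g, hg⟩

theorem sect_conj {X : Type*} {f g : TreeAut X} (hf : f ∈ levelStab X) (hg : g ∈ levelStab X)
    (x : X) : sect (f * g * f⁻¹) x = sect f x * sect g x * (sect f x)⁻¹ := by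
  have h := sect_inv f x
  rw [hf x] at h
  rw [sect_mul, sect_mul, (levelStab X).inv_mem hf x, hg x, h]

theorem sect_mul_of_mem {X : Type*} {f g : TreeAut X} (hg : g ∈ levelStab X) (x : X) :
    sect (f * g) x = sect f x * sect g x := by
  rw [sect_mul, hg x]

theorem sect_inv_of_mem {X : Type*} {f : TreeAut X} (hf : f ∈ levelStab X) (x : X) :
    sect f⁻¹ x = (sect f x)⁻¹ := by
  have h := sect_inv f x
  rwa [hf x] at h

/-- The sections at `i` of the elements of `M` in the first-level stabilizer whose sections at all
vertices in `T` are trivial. -/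
def restrictedSect {X : Type*} (M : Subgroup (TreeAut X)) (T : Set X) (i : X) :
    Subgroup (TreeAut X) where
  carrier := {g | ∃ m ∈ M, m ∈ levelStab X ∧ (∀ j ∈ T, sect m j = 1) ∧ sect m i = g}
  one_mem' := ⟨1, M.one_mem, Subgroup.one_mem _, fun j _ => sect_one j, sect_one i⟩
  mul_mem' := by
    rintro _ _ ⟨m, hm, h1, h2, rfl⟩ ⟨n, hn, h1', h2', rfl⟩
    refine ⟨m * n, M.mul_mem hm hn, Subgroup.mul_mem _ h1 h1', fun j hj => ?_,
      sect_mul_of_mem h1' i⟩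
    rw [sect_mul_of_mem h1', h2 j hj, h2' j hj, one_mul]
  inv_mem' := by
    rintro _ ⟨m, hm, h1, h2, rfl⟩
    refine ⟨m⁻¹, M.inv_mem hm, Subgroup.inv_mem _ h1, fun j hj => ?_, sect_inv_of_mem h1 i⟩
    rw [sect_inv_of_mem h1, h2 j hj, inv_one]

/-- The section of a commutator is trivial wherever one of the two sections is, so commutators
enlarge the set of killed vertices. -/
theorem commutator_mem_restrictedSect {X : Type*} {M : Subgroup (TreeAut X)} {S T : Set X} {i : X}
    {a b : TreeAut X} (ha : a ∈ restrictedSect M S i) (hb : b ∈ restrictedSect M T i) :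
    ⁅a, b⁆ ∈ restrictedSect M (S ∪ T) i := by
  obtain ⟨m, hm, h1, h2, rfl⟩ := ha
  obtain ⟨n, hn, h1', h2', rfl⟩ := hb
  refine ⟨⁅m, n⁆, ?_, ?_, ?_, sect_commutator h1 h1' i⟩
  · rw [commutatorElement_def]
    exact M.mul_mem (M.mul_mem (M.mul_mem hm hn) (M.inv_mem hm)) (M.inv_mem hn)
  · rw [commutatorElement_def]
    exact Subgroup.mul_mem _ (Subgroup.mul_mem _ (Subgroup.mul_mem _ h1 h1')
      (Subgroup.inv_mem _ h1)) (Subgroup.inv_mem _ h1')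
  · rintro j (hj | hj)
    · rw [sect_commutator h1 h1', h2 j hj, commutatorElement_one_left]
    · rw [sect_commutator h1 h1', h2' j hj, commutatorElement_one_right]

/-- An element of the first-level stabilizer lies in `M` if each of its sections does so as an
element supported on the corresponding subtree. -/
theorem mem_of_sect_mem {X : Type*} [Fintype X] {M : Subgroup (TreeAut X)} {f : TreeAut X}
    (hf : f ∈ levelStab X) (h : ∀ i, sect f i ∈ restrictedSect M {i}ᶜ i) : f ∈ M := by
  classical
  have key : ∀ T : Finset X, ∃ m ∈ M, m ∈ levelStab X ∧
      ∀ x, sect m x = if x ∈ T then sect f x else 1 := by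
    intro T
    induction T using Finset.induction_on with
    | empty => exact ⟨1, M.one_mem, Subgroup.one_mem _, fun x => by simp⟩
    | insert i T hi ih =>
      obtain ⟨m, hm, h1, h2⟩ := ih
      obtain ⟨n, hn, h1', h2', h3'⟩ := h i
      refine ⟨m * n, M.mul_mem hm hn, Subgroup.mul_mem _ h1 h1', fun x => ?_⟩
      rw [sect_mul_of_mem h1', h2]
      by_cases hx : x = i
      · subst hx
        simp [hi, h3']
      · simp [hx, h2' x hx]
  obtain ⟨m, hm, h1, h2⟩ := key Finset.univ
  have : f = m := treeAut_ext (fun x => by rw [hf x, h1 x]) fun x => by simp [h2]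
  rwa [this]

section
variable {p : ℕ} [Fact p.Prime] {W : Submodule (ZMod p) (DefiningVector p)}

theorem spinalB_ne_one {v : DefiningVector p} (hv : v ≠ 0) : spinalB v ≠ 1 := by
  intro h
  obtain ⟨j, hj, hvj⟩ := exists_coord_ne_zero hv
  have h1 := sect_spinalB v hj
  rw [h, sect_one, ← rot_zero] at h1
  exact hvj (rot_injective h1).symm

/-- If the two commuted, comparing sections at `0` would make `spinalB v` equal to a rotation; as it
fixes the first level, it would be trivial. -/
theorem commutator_spinalB_rot_ne_one {v : DefiningVector p} (hv : v ≠ 0) {k : ZMod p}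
    (hk : k ≠ 0) : ⁅spinalB v, rot k⁆ ≠ 1 := by
  intro h
  have h1 := commutatorElement_eq_one_iff_mul_comm.mp h
  have h2 := congrArg (fun f => sect f 0) h1
  simp only [sect_mul, act_rot, sect_rot, act_spinalB, zero_add, mul_one, one_mul,
    sect_spinalB_zero, sect_spinalB _ hk] at h2
  have h3 := congrArg (fun f => act f 0) h2
  simp only [act_rot, act_spinalB, zero_add] at h3
  rw [h3, rot_zero] at h2
  exact spinalB_ne_one hv h2.symm

theorem exists_sect_eq_one_ne_one (hs : ∀ v ∈ W, coordSum v = 0) (hW : W ≠ ⊥) {i j : ZMod p}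
    (hij : i ≠ j) : ∃ g ∈ spinalGroup W, g ∈ levelStab (ZMod p) ∧ sect g i = 1 ∧ sect g j ≠ 1 := by
  obtain ⟨v, hv, hv0⟩ := W.ne_bot_iff.mp hW
  -- With `d ≠ j - i`, the syllables based at `j` and `j - d` both have rotations as sections at
  -- `i`, which commute. At `j` they have sections `spinalB v` and a nontrivial rotation, which do
  -- not.
  obtain ⟨d, hd, hdi, hvd⟩ := exists_coord_ne_zero_ne hv0 (hs v hv) (j - i)
  have hm : ∀ k, syl k v ∈ spinalGroup W := fun k => syl_mem_spinalGroup k ⟨v, hv⟩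
  have hl : ∀ k, syl k v ∈ levelStab (ZMod p) := fun k x => act_syl k x v
  have hjd : j ≠ j - d := fun h => hd (sub_eq_self.mp h.symm)
  have hid : i ≠ j - d := fun h => hdi (by rw [h]; ring)
  refine ⟨⁅syl j v, syl (j - d) v⁆, ?_, ?_, ?_, ?_⟩
  · rw [commutatorElement_def]
    exact Subgroup.mul_mem _ (Subgroup.mul_mem _ (Subgroup.mul_mem _ (hm _) (hm _))
      (Subgroup.inv_mem _ (hm _))) (Subgroup.inv_mem _ (hm _))
  · rw [commutatorElement_def]
    exact Subgroup.mul_mem _ (Subgroup.mul_mem _ (Subgroup.mul_mem _ (hl _) (hl _))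
      (Subgroup.inv_mem _ (hl _))) (Subgroup.inv_mem _ (hl _))
  · rw [sect_commutator (hl _) (hl _), sect_syl hij, sect_syl hid,
      commutatorElement_eq_one_iff_mul_comm, ← rot_add, ← rot_add, add_comm]
  · rw [sect_commutator (hl _) (hl _), sect_syl_self, sect_syl hjd, sub_sub_cancel]
    exact commutator_spinalB_rot_ne_one hv0 hvd

/-- Density makes `M` transitive on the first level, and an element moving `y` to `x` conjugates one
section group into the other. -/
theorem sectGroup_eq_of_eq {M : Subgroup (TreeAut (ZMod p))} (h : DenseIn (spinalGroup W) M)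
    {x : ZMod p} (hx : sectGroup M x = spinalGroup W) (y : ZMod p) :
    sectGroup M y = spinalGroup W := by
  refine le_antisymm (sectGroup_le h.le y) fun g hg => ?_
  obtain ⟨t, ht, rfl⟩ := h.exists_act_eq y x
  have h1 := sect_mem_spinalGroup (h.le ht) y
  have h2 := (spinalGroup W).mul_mem ((spinalGroup W).mul_mem h1 hg) ((spinalGroup W).inv_mem h1)
  rw [← hx] at h2
  have h3 := conj_mem_sectGroup ht h2
  simpa [mul_assoc] using h3

theorem restrictedSect_le {M : Subgroup (TreeAut (ZMod p))} (hM : M ≤ spinalGroup W)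
    (T : Set (ZMod p)) (i : ZMod p) : restrictedSect M T i ≤ spinalGroup W := by
  rintro _ ⟨m, hm, -, -, rfl⟩
  exact sect_mem_spinalGroup (hM hm) i

theorem conj_mem_restrictedSect {M : Subgroup (TreeAut (ZMod p))} (hM : M ≤ spinalGroup W)
    {T : Set (ZMod p)} {i : ZMod p} (hi : sectGroup M i = spinalGroup W) {g n : TreeAut (ZMod p)}
    (hg : g ∈ spinalGroup W) (hn : n ∈ restrictedSect M T i) :
    g * n * g⁻¹ ∈ restrictedSect M T i := by
  rw [← hi] at hg
  obtain ⟨f, hf, hfi, rfl⟩ := hg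
  obtain ⟨m, hm, h1, h2, rfl⟩ := hn
  have hfl := mem_levelStab_of_mem (hM hf) hfi
  refine ⟨f * m * f⁻¹, M.mul_mem (M.mul_mem hf hm) (M.inv_mem hf),
    Subgroup.mul_mem _ (Subgroup.mul_mem _ hfl h1) (Subgroup.inv_mem _ hfl), fun j hj => ?_,
    sect_conj hfl h1 i⟩
  rw [sect_conj hfl h1, h2 j hj, mul_one, mul_inv_cancel]

/-- Density keeps the sections at two first-level vertices from determining each other. -/
theorem restrictedSect_singleton_ne_bot (hs : ∀ v ∈ W, coordSum v = 0) (hW : W ≠ ⊥)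
    {M : Subgroup (TreeAut (ZMod p))} (h : DenseIn (spinalGroup W) M) {i j : ZMod p} (hij : i ≠ j)
    (hi : sectGroup M i = spinalGroup W) : restrictedSect M {i} j ≠ ⊥ := by
  intro hbot
  obtain ⟨g, hg, hgl, hgi, hgj⟩ := exists_sect_eq_one_ne_one hs hW hij
  obtain ⟨N, hN, hgN⟩ := exists_index_ne_zero_notMem hgj
  let K := M.subgroupOf (levelStab (ZMod p))
  -- The sections at `i` of `H` form a finite-index subgroup. Density then gives `m` in `M`, close
  -- to `g`, that shares its section at `i` with some `f` in `H`. Were sections at `i` to determine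
  -- those at `j`, the section of `m` at `j` would lie in `N`, and so would that of `g`.
  let H := K ⊓ N.comap (sectHom j)
  have hQ : (H.map (sectHom i)).relIndex (spinalGroup W) ≠ 0 := by
    rw [← hi, ← map_sectHom h.le]
    refine relIndex_map_ne_zero _ ?_
    rw [Subgroup.inf_relIndex_left, Subgroup.relIndex_comap]
    exact relIndex_ne_zero_of_index _ hN
  obtain ⟨m, hm, hmN⟩ := h.exists_mem _ (Subgroup.relIndex_inf_ne_zero
    (relIndex_sectPreimage_ne_zero i hQ)
    (relIndex_sectPreimage_ne_zero j (relIndex_ne_zero_of_index _ hN))) g hg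
  obtain ⟨h1, h2⟩ := hmN
  obtain ⟨hl, ⟨f, hfl⟩, ⟨hfM, hfN⟩, hfi⟩ := mem_sectPreimage.mp h1
  obtain ⟨-, hjN⟩ := mem_sectPreimage.mp h2
  have hml : m ∈ levelStab (ZMod p) := by
    simpa using (levelStab (ZMod p)).mul_mem hgl hl
  rw [sect_mul_of_mem hml, sect_inv_of_mem hgl] at hfi hjN
  rw [hgi, inv_one, one_mul] at hfi
  change sect f i = sect m i at hfi
  change sect f j ∈ N at hfN
  have hmem : sect (m * f⁻¹) j ∈ restrictedSect M {i} j := by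
    refine ⟨m * f⁻¹, M.mul_mem hm (M.inv_mem hfM),
      Subgroup.mul_mem _ hml (Subgroup.inv_mem _ hfl), ?_, rfl⟩
    rintro _ rfl
    rw [sect_mul_of_mem (Subgroup.inv_mem _ hfl), sect_inv_of_mem hfl, hfi, mul_inv_cancel]
  rw [hbot, Subgroup.mem_bot, sect_mul_of_mem (Subgroup.inv_mem _ hfl), sect_inv_of_mem hfl,
    mul_inv_eq_one] at hmem
  rw [hmem] at hjN
  have := N.mul_mem hfN (N.inv_mem hjN)
  rw [mul_inv_rev, inv_inv, mul_inv_cancel_left] at this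
  exact hgN this

/-- If the sections of a dense subgroup at a first-level vertex form the whole group, the dense
subgroup is the whole group. -/
theorem eq_of_sectGroup_eq (hs : ∀ v ∈ W, coordSum v = 0) (hW : W ≠ ⊥) [Infinite (spinalGroup W)]
    (hJ : ∀ N ≤ spinalGroup W, (∀ g ∈ spinalGroup W, ∀ n ∈ N, g * n * g⁻¹ ∈ N) → N ≠ ⊥ →
      N.relIndex (spinalGroup W) ≠ 0)
    {M : Subgroup (TreeAut (ZMod p))} (h : DenseIn (spinalGroup W) M) {x : ZMod p}
    (hx : sectGroup M x = spinalGroup W) : M = spinalGroup W := by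
  have hall := sectGroup_eq_of_eq h hx
  have hfin : ∀ T i, restrictedSect M T i ≠ ⊥ →
      (restrictedSect M T i).relIndex (spinalGroup W) ≠ 0 := fun T i =>
    hJ _ (restrictedSect_le h.le T i) fun g hg n hn => conj_mem_restrictedSect h.le (hall i) hg hn
  -- The vertices of `T` are killed one at a time. If killing one more left only the identity, two
  -- finite-index subgroups would commute elementwise, and their intersection would be abelian of
  -- finite index.
  have hne : ∀ i, ∀ T : Finset (ZMod p), i ∉ T → restrictedSect M T i ≠ ⊥ := by
    intro i T
    induction T using Finset.induction_on with
    | empty =>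
      intro _ hbot
      have h1 : ∀ g ∈ spinalGroup W, g = 1 := by
        intro g hg
        rw [← hall i] at hg
        obtain ⟨m, hm, hmi, rfl⟩ := hg
        have : sect m i ∈ restrictedSect M ((∅ : Finset (ZMod p)) : Set (ZMod p)) i :=
          ⟨m, hm, mem_levelStab_of_mem (h.le hm) hmi, by simp, rfl⟩
        rwa [hbot, Subgroup.mem_bot] at this
      have : Subsingleton (spinalGroup W) :=
        ⟨fun a b => Subtype.ext ((h1 a a.2).trans (h1 b b.2).symm)⟩
      exact not_finite (spinalGroup W)
    | insert j T hj ih =>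
      intro hi hbot
      simp only [Finset.mem_insert, not_or] at hi
      have h1 := hfin _ _ (ih hi.2)
      have h2 := hfin _ _ (restrictedSect_singleton_ne_bot hs hW h (Ne.symm hi.1) (hall j))
      refine not_virtually_abelian hs (Subgroup.relIndex_inf_ne_zero h1 h2) ?_
      rintro a ⟨ha, -⟩ b ⟨-, hb⟩
      have h3 := commutator_mem_restrictedSect ha hb
      rw [Set.union_comm, Set.singleton_union, ← Finset.coe_insert, hbot, Subgroup.mem_bot] at h3
      exact commutatorElement_eq_one_iff_mul_comm.mp h3
  have hR : ∀ i, (restrictedSect M {i}ᶜ i).relIndex (spinalGroup W) ≠ 0 := by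
    intro i
    have := hfin _ _ (hne i (Finset.univ.erase i) (by simp))
    have hT : ((Finset.univ.erase i : Finset (ZMod p)) : Set (ZMod p)) = {i}ᶜ := by
      ext; simp
    rwa [hT] at this
  -- The elements whose section at each `i` is realized in `M` with support below `i` form a
  -- finite-index subgroup contained in `M`.
  refine h.eq_of_relIndex_ne_zero
    (Subgroup.relIndex_iInf_ne_zero fun i => relIndex_sectPreimage_ne_zero i (hR i)) ?_
  intro f hf
  rw [Subgroup.mem_iInf] at hf
  exact mem_of_sect_mem (mem_sectPreimage.mp (hf 0)).1 fun i => (mem_sectPreimage.mp (hf i)).2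

end

/-! ### Descent: from one element to a full section group. -/

section
variable {p : ℕ} [Fact p.Prime] {W : Submodule (ZMod p) (DefiningVector p)}

theorem HasWord.rot_mul {n : ℕ} {g : TreeAut (ZMod p)} {k : ZMod p} {v : W}
    (h : HasWord W n g k v) : HasWord W n (rot (-k) * g) 0 v := by
  simpa using (HasWord.of_rot W (-k)).mul h

theorem rot_mem_sectGroup {M : Subgroup (TreeAut (ZMod p))} {v : DefiningVector p}
    (hv : spinalB v ∈ M) {j : ZMod p} (hj : j ≠ 0) (hvj : coord v j ≠ 0) (l : ZMod p) :
    rot l ∈ sectGroup M j := by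
  have := sect_mem_sectGroup hv (act_spinalB v j)
  rw [sect_spinalB v hj] at this
  exact rot_mem_of_rot_mem hvj this l

theorem spinalB_mem_sectGroup {M : Subgroup (TreeAut (ZMod p))} {v : DefiningVector p}
    (hv : spinalB v ∈ M) : spinalB v ∈ sectGroup M 0 := by
  have := sect_mem_sectGroup hv (act_spinalB v 0)
  rwa [sect_spinalB_zero] at this

/-- The vectors of `W` whose directed automorphisms lie in `M`. -/
def vectorGroup (W : Submodule (ZMod p) (DefiningVector p)) (M : Subgroup (TreeAut (ZMod p))) :
    AddSubgroup W where
  carrier := {w | spinalB w.1 ∈ M}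
  zero_mem' := by
    change spinalB (0 : DefiningVector p) ∈ M
    rw [spinalB_zero]
    exact M.one_mem
  add_mem' := fun {v w} hv hw => by
    change spinalB (v.1 + w.1) ∈ M
    rw [spinalB_add]
    exact M.mul_mem hv hw
  neg_mem' := fun {v} hv => by
    change spinalB (-v.1) ∈ M
    rw [spinalB_neg]
    exact M.inv_mem hv

theorem sectGroup_le_of_rot_mem {M : Subgroup (TreeAut (ZMod p))} (hr : ∀ k, rot k ∈ M)
    (x y : ZMod p) : sectGroup M y ≤ sectGroup M x := by
  intro g hg
  have h : act (rot (y - x)) x = y := by simp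
  rw [← h] at hg
  simpa using conj_mem_sectGroup (hr (y - x)) hg

/-- With all rotations present, the section groups at all letters coincide and again contain the
rotations and the known directed automorphisms. An element of `M` whose vector `w` is not yet known
always has a section with unknown vector, so shortening ends in a single syllable and yields a new
directed automorphism. -/
theorem eq_of_rot_mem (hW : W ≠ ⊥)
    (hback : ∀ M x, DenseIn (spinalGroup W) M → sectGroup M x = spinalGroup W →
      M = spinalGroup W)
    {v : W} (hv : v ≠ 0) {M : Subgroup (TreeAut (ZMod p))} (h : DenseIn (spinalGroup W) M)
    (hr : ∀ k, rot k ∈ M) (hvM : spinalB v.1 ∈ M) : M = spinalGroup W := by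
  -- Outer induction on the subgroup `U` of known vectors, upwards in the finite group `W`; inner
  -- induction on word length with `U` fixed.
  have key : ∀ U : AddSubgroup W, v ∈ U → ∀ M, DenseIn (spinalGroup W) M → (∀ k, rot k ∈ M) →
      U ≤ vectorGroup W M → M = spinalGroup W := by
    intro U
    induction U using WellFoundedGT.induction with
    | _ U ih =>
      intro hvU M h hr hU
      by_cases hUtop : ∀ w, w ∈ U
      · exact le_antisymm h.le (spinalGroup_le hr fun w => hU (hUtop w))
      push Not at hUtop
      obtain ⟨w, hw⟩ := hUtop
      obtain ⟨m, hm, n, hmw⟩ := h.exists_hasWord 0 w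
      -- The inner induction needs an arbitrary rotation, since sections carry one.
      generalize (0 : ZMod p) = k at hmw
      induction n using Nat.strong_induction_on generalizing M m k w with
      | _ n ihn =>
        have hmM : rot (-k) * m ∈ M := M.mul_mem (hr _) hm
        have hmw' : HasWord W n (rot (-k) * m) 0 w := hmw.rot_mul
        obtain ⟨D⟩ := hmw'.exists_sectData
        rcases D.single_or_lt with ⟨x, hx⟩ | hlt
        · refine ih (vectorGroup W M) (lt_of_le_of_ne hU fun hEq => hw ?_) (hU hvU) M h hr le_rfl
          rw [hEq]
          have h1 := M.mul_mem (M.mul_mem (hr (-x)) hmM) (hr x)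
          rw [hx] at h1
          change spinalB w.1 ∈ M
          convert! h1 using 1
          simp [syl, rot_neg, mul_assoc]
        · have hex : ∃ x, D.vec x ∉ U := by
            by_contra! hall
            apply hw
            rw [← D.sum_vec]
            exact U.sum_mem fun x _ => hall x
          obtain ⟨x, hx⟩ := hex
          obtain ⟨j, hj, hvj⟩ := exists_coord_ne_zero (v := v.1) (by simpa using hv)
          refine hback M x h (ihn (D.cnt x) (hlt x) (sectGroup M x) (h.sectGroup hW x)
            (fun l => ?_) (fun u hu => ?_) (D.vec x) hx (sect (rot (-k) * m) x)
            (sect_mem_sectGroup hmM (by simp [hmw'.act_eq])) (D.rt x) (D.rep x))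
          · exact sectGroup_le_of_rot_mem hr x j (rot_mem_sectGroup (hU hvU) hj hvj l)
          · exact sectGroup_le_of_rot_mem hr x 0 (spinalB_mem_sectGroup (hU hu))
  exact key _ hvM M h hr le_rfl

/-- Induction on the length of the conjugator `h`. The element `h⁻¹ * rot j * h` carries `0` to `j`,
so the section group at `0` contains rotations conjugated by `(sect h j)⁻¹ * sect h 0`. This is
shorter than `h` for a suitable `j`, unless `h` is a directed automorphism. -/
theorem eq_of_conj_rot_mem (hs : ∀ v ∈ W, coordSum v = 0) (hW : W ≠ ⊥)
    (hback : ∀ M x, DenseIn (spinalGroup W) M → sectGroup M x = spinalGroup W →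
      M = spinalGroup W)
    {v : W} (hv : v ≠ 0) {n : ℕ} {h : TreeAut (ZMod p)} {k : ZMod p} {w : W}
    (hw : HasWord W n h k w) {M : Subgroup (TreeAut (ZMod p))} (hM : DenseIn (spinalGroup W) M)
    (hvM : spinalB v.1 ∈ M) (hr : ∀ l, h⁻¹ * rot l * h ∈ M) : M = spinalGroup W := by
  have hv' : v.1 ≠ 0 := by simpa using hv
  induction n using Nat.strong_induction_on generalizing M h k w with
  | _ n ih =>
    -- Rotations commute, so removing the rotation of `h` on the left does not change the conjugates
    -- `h⁻¹ * rot l * h`.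
    wlog hk : k = 0 generalizing h k
    · refine this (h := rot (-k) * h) hw.rot_mul (fun l => ?_) rfl
      convert! hr l using 1
      rw [mul_inv_rev, rot_neg, inv_inv, mul_assoc h⁻¹, mul_assoc, mul_assoc, mul_assoc,
        ← mul_assoc (rot l) _ h, ← rot_neg, ← rot_add, add_comm l, rot_add, ← mul_assoc (rot k),
        ← mul_assoc (rot k), ← rot_add, add_neg_cancel, rot_zero, one_mul]
    subst hk
    have hl : h ∈ levelStab (ZMod p) := fun x => by simp [hw.act_eq]
    obtain ⟨D⟩ := hw.exists_sectData
    have step : ∀ j, j ≠ 0 → coord v.1 j ≠ 0 → D.cnt j + D.cnt 0 < n → M = spinalGroup W := by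
      intro j hj hvj hlt
      have hact : act (h⁻¹ * rot j * h) 0 = j := by
        rw [act_mul, act_mul, hl 0, act_rot, zero_add, (levelStab _).inv_mem hl]
      have hsect : sect (h⁻¹ * rot j * h) 0 = (sect h j)⁻¹ * sect h 0 := by
        rw [sect_mul, sect_mul, hl 0, act_rot, zero_add, sect_rot, mul_one, sect_inv_of_mem hl]
      have hword := (D.rep j).inv.mul (D.rep 0)
      rw [← hsect] at hword
      refine hback M 0 hM (ih _ hlt hword (hM.sectGroup hW 0) (spinalB_mem_sectGroup hvM)
        fun l => conj_mem_sectGroup (hr j) ?_)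
      rw [hact]
      exact rot_mem_sectGroup hvM hj hvj l
    -- Vanishing coordinate sum provides two usable letters. If neither shortens the conjugator, the
    -- count inequalities force every syllable of `h` into the section at `0`.
    obtain ⟨j, hj, -, hvj⟩ := exists_coord_ne_zero_ne hv' (hs v v.2) 0
    obtain ⟨i, hi, hij, hvi⟩ := exists_coord_ne_zero_ne hv' (hs v v.2) j
    by_cases h1 : D.cnt j + D.cnt 0 < n
    · exact step j hj hvj h1
    by_cases h2 : D.cnt i + D.cnt 0 < n
    · exact step i hi hvi h2
    have hsum := D.sum_cnt
    have h3 : D.cnt 0 + (D.cnt i + D.cnt j) ≤ ∑ x, D.cnt x := by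
      have := Finset.sum_le_sum_of_subset (f := D.cnt) (Finset.subset_univ {0, i, j})
      rwa [Finset.sum_insert (by simp [hi.symm, hj.symm]), Finset.sum_pair hij] at this
    have hh := D.single 0 fun y hy => by
      have := Finset.add_le_sum (f := D.cnt) (fun _ _ => Nat.zero_le _) (Finset.mem_univ y)
        (Finset.mem_univ 0) hy
      omega
    rw [add_zero, rot_zero, mul_one, syl_zero_left] at hh
    have hwG := spinalB_mem_spinalGroup w
    -- Now `h = spinalB w`. Conjugating `M` by it straightens the rotations and leaves `spinalB v`
    -- unchanged, since directed automorphisms commute.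
    refine eq_of_map_conj_eq hwG (eq_of_rot_mem hW hback hv (hM.conj hwG) (fun l => ?_) ?_)
    · refine ⟨_, hr l, ?_⟩
      simp [hh, mul_assoc]
    · refine ⟨_, hvM, ?_⟩
      simp [← spinalB_neg, ← spinalB_add]

/-- After rotating the syllable to `spinalB v`, the section group at `0` contains `spinalB v`, and
the one at `j` contains all rotations. An element carrying `0` to `j` transports these rotations,
conjugated by its section, to the section group at `0`. -/
theorem eq_of_syl_mem (hs : ∀ v ∈ W, coordSum v = 0) (hW : W ≠ ⊥)
    (hback : ∀ M x, DenseIn (spinalGroup W) M → sectGroup M x = spinalGroup W →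
      M = spinalGroup W)
    {v : W} (hv : v ≠ 0) {x : ZMod p} {M : Subgroup (TreeAut (ZMod p))}
    (hM : DenseIn (spinalGroup W) M) (hvM : syl x v.1 ∈ M) : M = spinalGroup W := by
  have hxG := rot_mem_spinalGroup W (-x)
  refine eq_of_map_conj_eq hxG ?_
  have hM' := hM.conj hxG
  have hvM' : spinalB v.1 ∈ M.map (MulAut.conj (rot (-x))).toMonoidHom :=
    ⟨_, hvM, by simp [syl, rot_neg, mul_assoc]⟩
  generalize M.map (MulAut.conj (rot (-x))).toMonoidHom = N at hM' hvM'
  obtain ⟨j, hj, hvj⟩ := exists_coord_ne_zero (v := v.1) (by simpa using hv)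
  obtain ⟨t, ht, htj⟩ := hM'.exists_act_eq 0 j
  obtain ⟨n, k, w, hw⟩ := sect_mem_spinalGroup (hM'.le ht) 0
  refine hback N 0 hM' (eq_of_conj_rot_mem hs hW hback hv hw (hM'.sectGroup hW 0)
    (spinalB_mem_sectGroup hvM') fun l => conj_mem_sectGroup ht ?_)
  rw [htj]
  exact rot_mem_sectGroup hvM' hj hvj l

/-- Section vectors add up to `v ≠ 0`, so some section has a nonzero vector, and it is shorter
unless a single syllable remains. -/
theorem eq_of_hasWord_mem (hs : ∀ v ∈ W, coordSum v = 0) (hW : W ≠ ⊥)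
    (hback : ∀ M x, DenseIn (spinalGroup W) M → sectGroup M x = spinalGroup W →
      M = spinalGroup W)
    {v : W} (hv : v ≠ 0) {n : ℕ} {m : TreeAut (ZMod p)} {k : ZMod p} (hm : HasWord W n m k v)
    {M : Subgroup (TreeAut (ZMod p))} (hM : DenseIn (spinalGroup W) M) (hmM : m ∈ M) :
    M = spinalGroup W := by
  induction n using Nat.strong_induction_on generalizing M m k v with
  | _ n ih =>
    have key : ∀ M m, HasWord W n m 0 v → DenseIn (spinalGroup W) M → m ∈ M →
        M = spinalGroup W := by
      intro M m hm hM hmM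
      obtain ⟨D⟩ := hm.exists_sectData
      rcases D.single_or_lt with ⟨x, hx⟩ | hlt
      · rw [rot_zero, mul_one] at hx
        exact eq_of_syl_mem hs hW hback hv hM (hx ▸ hmM)
      · have hex : ∃ x, D.vec x ≠ 0 := by
          by_contra! hall
          exact hv (by rw [← D.sum_vec]; simp [hall])
        obtain ⟨x, hx⟩ := hex
        exact hback M x hM (ih _ (hlt x) hx (D.rep x) (hM.sectGroup hW x)
          (sect_mem_sectGroup hmM (by simp [hm.act_eq])))
    by_cases hk : k = 0
    · exact key M m (hk ▸ hm) hM hmM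
    -- The section of the `p`-th power keeps the vector and the length bound, while its rotation
    -- becomes `coordSum v = 0`.
    · obtain ⟨h1, h2⟩ := hm.pow_prime hk 0
      rw [hs v v.2] at h2
      exact hback M 0 hM (key _ _ h2 (hM.sectGroup hW 0)
        (sect_mem_sectGroup (M.pow_mem hmM p) h1))

/-- A just infinite spinal group has no proper dense torsion subgroups. -/
theorem eq_of_denseIn_of_torsion (hW : W ≠ ⊥) [Infinite (spinalGroup W)]
    (hJ : ∀ N ≤ spinalGroup W, (∀ g ∈ spinalGroup W, ∀ n ∈ N, g * n * g⁻¹ ∈ N) → N ≠ ⊥ →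
      N.relIndex (spinalGroup W) ≠ 0)
    {M : Subgroup (TreeAut (ZMod p))} (hM : DenseIn (spinalGroup W) M)
    (htor : ∀ m ∈ M, IsOfFinOrder m) : M = spinalGroup W := by
  have hs : ∀ v ∈ W, coordSum v = 0 := by
    intro v hv
    by_contra hne
    -- The rotation `1` is nontrivial, so this element of `M` would have infinite order.
    obtain ⟨m, hm, n, hmv⟩ := hM.exists_hasWord 1 ⟨v, hv⟩
    exact hmv.not_isOfFinOrder one_ne_zero hne (htor m hm)
  obtain ⟨v, hv, hv0⟩ := W.ne_bot_iff.mp hW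
  obtain ⟨m, hm, n, hmv⟩ := hM.exists_hasWord 0 ⟨v, hv⟩
  exact eq_of_hasWord_mem hs hW (fun M x h hx => eq_of_sectGroup_eq hs hW hJ h hx)
    (by simpa using hv0) hmv hM hm

end

/-! ### Translation to the profinite topology. -/

theorem theorem5p6 (p : ℕ) [Fact p.Prime] (hp : Odd p) (r : ℕ) (hr : 0 < r)
    (E : Fin r → DefiningVector p) (hE : LinearIndependent (ZMod p) E)
    (hji : IsJustInfinite (multiEdgeSpinalGroup E))
    (hnotE : ¬ ∃ (f : TreeAut (ZMod p)) (K : Subgroup (TreeAut (ZMod p))),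
      InFamilyE K ∧ multiEdgeSpinalGroup E = K.map (MulAut.conj f).toMonoidHom) :
    ¬ ∃ M : Subgroup (multiEdgeSpinalGroup E),
      M ≠ ⊤ ∧ IsMulTorsion M ∧
        @Dense (multiEdgeSpinalGroup E) (profiniteTopology (multiEdgeSpinalGroup E))
          (M : Set (multiEdgeSpinalGroup E)) := by
  have hW : Submodule.span (ZMod p) (Set.range E) ≠ ⊥ := by
    intro h
    have := Submodule.subset_span (R := ZMod p) (Set.mem_range_self (f := E) ⟨0, hr⟩)
    rw [h] at this
    exact hE.ne_zero ⟨0, hr⟩ ((Submodule.mem_bot _).mp this)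
  rw [multiEdgeSpinalGroup_eq E] at hji ⊢
  set G := spinalGroup (Submodule.span (ZMod p) (Set.range E))
  rintro ⟨M, hM, htor, hdense⟩
  obtain ⟨hinf, hfin⟩ := hji
  apply hM
  have hdense' : DenseIn G (M.map G.subtype) := by
    refine ⟨Subgroup.map_subtype_le M, fun N hN g hg => ?_⟩
    let _ : TopologicalSpace G := profiniteTopology G
    have hopen : IsOpen ((fun x => (⟨g, hg⟩ : G) * x) '' (N.subgroupOf G : Set G)) :=
      TopologicalSpace.isOpen_generateFrom_of_mem ⟨_, _, ⟨hN⟩, rfl⟩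
    obtain ⟨_, ⟨n, hn, rfl⟩, hnM⟩ := Dense.inter_open_nonempty hdense _ hopen
      ⟨_, 1, Subgroup.one_mem _, rfl⟩
    refine ⟨_, ⟨_, hnM, rfl⟩, ?_⟩
    have hn' : n.1 ∈ N := hn
    simpa using hn'
  have hJ : ∀ N ≤ G, (∀ g ∈ G, ∀ n ∈ N, g * n * g⁻¹ ∈ N) → N ≠ ⊥ → N.relIndex G ≠ 0 := by
    intro N hNG hnorm hne
    refine (hfin (N.subgroupOf G) ⟨fun n hn g => hnorm g g.2 n hn⟩ fun hbot => hne ?_).index_ne_zero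
    rw [Subgroup.subgroupOf_eq_bot] at hbot
    exact (disjoint_of_le_iff_left_eq_bot hNG).mp hbot
  have := eq_of_denseIn_of_torsion hW hJ hdense' (by
    rintro _ ⟨m, hm, rfl⟩
    have h1 := htor ⟨m, hm⟩
    exact (G.subtype.comp M.subtype).isOfFinOrder h1)
  refine Subgroup.map_injective G.subtype_injective (this.trans ?_)
  rw [← MonoidHom.range_eq_map, G.range_subtype]
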